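/- **Setting.** Let $\Omega\subset\mathbb R^2$ be the fluid region in one period, of length $L>0$, of a channel carrying one particle: a bounded connected open set with $\partial\Omega=\Gamma^+\cup\Gamma^-\cup\gamma\cup\Gamma_0\cup\Gamma_L$, where $\Gamma_0=\{0\}\times[a,b]$ and $\Gamma_L=\{L\}\times[a,b]$ ($a<b$) are the end sections; the walls $\Gamma^\pm$ are one period of two disjoint simple $C^1$ curves $x^\pm$ parametrized by arclength and directed leftwards, with $x^+(0)=(L,b)$, $x^-(0)=(L,a)$, $x^\pm(s+\ell^\pm)=x^\pm(s)-Le_1$, which meet the end sections only at their endpoints; and the particle contour $\gamma$ is a simple closed $C^1$ curve disjoint from the walls and the end sections. Apart from corners, $\Omega$ lies locally on one side of its boundary; $n$ is the unit normal outward to $\Omega$, and the unit tangent $\tau$ on $\gamma$ is oriented so that $n=r\cdot\tau$, where $r:=e_2\otimes e_1-e_1\otimes e_2$. Put $\Gamma=\Gamma^+\cup\Gamma^-$. The whole channel is the union of the translates by $kLe_1$, $k\in\mathbb Z$, of $\Omega$ and of the open section $\{L\}\times(a,b)$. Let $\Omega_{\rm all}\supset\overline\Omega$ be open. Conventions: $(\nabla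 u)_{ij}=\partial_ju_i$, $D[u]=\frac12(\nabla u+\nabla^{\rm T}u)$, $\sigma[u,p]=-pI+2D[u]$, $A:B=\sum_{ij}A_{ij}B_{ij}$, $(n\cdot A)_j=\sum_in_iA_{ij}$, and $$E\big((u,p),(v,q)\big)=2(D[u]:D[v])I-2D[u]\cdot\nabla v-2D[v]\cdot\nabla u+p\,[\nabla v-({\rm div}\,v)I]+q\,[\nabla u-({\rm div}\,u)I].$$ **Lemma.** Let $(u,p)$ and $(\hat u,\hat p)$ be classical solutions, with velocities in $C^2(\Omega)$ and pressures in $C^1(\Omega)$, of $${\rm div}\,u=0,\quad-\Delta u+\nabla p=0,\qquad {\rm div}\,\hat u=0,\quad-\Delta\hat u+\nabla\hat p=0\qquad\text{in }\Omega,$$ such that $u,\nabla u,p,\hat u,\nabla\hat u,\hat p$ extend continuously from $\Omega$ to $\overline\Omega$ (boundary values below are those of these extensions). Assume that $u$ and $\hat u$ are periodic, i.e. they are $C^1$ and $L$-periodic in $x_1$ in the whole channel, and that $p$ is periodic, i.e. continuous and $L$-periodic in $x_1$ in the whole channel. Periodicity is not assumed for $\hat p$; set $\Delta\hat p(x_2)=\hat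 p(L,x_2)-\hat p(0,x_2)$. 1. For every $C^1$ vector field $\zeta$ on $\Omega_{\rm all}$ that vanishes near $\partial\Omega_{\rm all}$ and satisfies $\zeta(0,x_2)=\zeta(L,x_2)$ and $\zeta_1(0,x_2)=0$ for all $x_2\in[a,b]$, $$\int_\Omega E\big((u,p),(\hat u,\hat p)\big):\nabla^{\rm T}\zeta\,dV=\int_{\Gamma\cup\gamma}n\cdot E\big((u,p),(\hat u,\hat p)\big)\cdot\zeta\,ds+\int_{\Gamma_L}\Delta\hat p\,(\partial_2u_1)\,\zeta_2\,ds.$$ 2. On $\gamma$ one has $r=n\otimes\tau-\tau\otimes n$. Moreover, if $u(x)=w+\varrho\,r\cdot x$ and $\hat u(x)=\hat w+\hat\varrho\,r\cdot x$ on $\gamma$ for some $w,\hat w\in\mathbb R^2$ and $\varrho,\hat\varrho\in\mathbb R$, then $$n\cdot E\big((u,p),(\hat u,\hat p)\big)=-(\hat\varrho\,h+\varrho\,\hat h)\cdot r-h_s\hat h_s\,n\qquad\text{on }\gamma,$$ where $h=\sigma[u,p]\cdot n$, $\hat h=\sigma[\hat u,\hat p]\cdot n$, $h_s=h\cdot\tau$,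 $\hat h_s=\hat h\cdot\tau$. -/

import Mathlib

open Set Filter Topology Matrix

noncomputable section

namespace StokesChannel

/-- The Euclidean plane; coordinates `x 0`, `x 1` are the usual `x₁`, `x₂`. -/
abbrev Plane : Type := EuclideanSpace ℝ (Fin 2)

/-- The unit vector along the channel axis. -/
def e₁ : Plane := !₂[1, 0]

/-- The skew-symmetric tensor `r = e₂ ⊗ e₁ - e₁ ⊗ e₂`. -/
def rot : Matrix (Fin 2) (Fin 2) ℝ := !![0, -1; 1, 0]

/-- The vector `r · v = e₃ × v`. -/
def rotate (v : Plane) : Plane := WithLp.toLp 2 (rot *ᵥ v.ofLp)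

/-! ### Differential operators and tensors

The convention for the velocity gradient is `(∇u)ᵢⱼ = ∂ⱼ uᵢ`. -/

/-- The gradient `(∇u)ᵢⱼ = ∂ⱼ uᵢ` of a vector field. -/
def grad (u : Plane → Plane) (x : Plane) : Matrix (Fin 2) (Fin 2) ℝ :=
  Matrix.of fun i j => fderiv ℝ u x (EuclideanSpace.single j 1) i

/-- The divergence of a vector field. -/
def div (u : Plane → Plane) (x : Plane) : ℝ := (grad u x).trace

/-- The strain rate tensor `D[u] = (∇u + ∇ᵀu) / 2`. -/
def strain (u : Plane → Plane) (x : Plane) : Matrix (Fin 2) (Fin 2) ℝ :=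
  (1 / 2 : ℝ) • (grad u x + (grad u x)ᵀ)

/-- The (non-dimensional) stress tensor `σ[u,p] = -p I + 2 D[u]`. -/
def stress (u : Plane → Plane) (p : Plane → ℝ) (x : Plane) : Matrix (Fin 2) (Fin 2) ℝ :=
  -(p x • (1 : Matrix (Fin 2) (Fin 2) ℝ)) + (2 : ℝ) • strain u x

/-- The double inner product `A : B = ∑ᵢⱼ Aᵢⱼ Bᵢⱼ`. -/
def ddot (A B : Matrix (Fin 2) (Fin 2) ℝ) : ℝ := ∑ i, ∑ j, A i j * B i j

/-- The tensor field `E((u,p),(v,q))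
`= 2 (D[u]:D[v]) I - 2 D[u]·∇v - 2 D[v]·∇u + p [∇v - (div v) I] + q [∇u - (div u) I]`. -/
def tensorE (u : Plane → Plane) (p : Plane → ℝ) (v : Plane → Plane) (q : Plane → ℝ)
    (x : Plane) : Matrix (Fin 2) (Fin 2) ℝ :=
  (2 * ddot (strain u x) (strain v x)) • (1 : Matrix (Fin 2) (Fin 2) ℝ)
    - (2 : ℝ) • (strain u x * grad v x) - (2 : ℝ) • (strain v x * grad u x)
    + p x • (grad v x - div v x • (1 : Matrix (Fin 2) (Fin 2) ℝ))
    + q x • (grad u x - div u x • (1 : Matrix (Fin 2) (Fin 2) ℝ))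

/-! ### Boundary traces -/

/-- `f`, restricted to `Ω`, extends continuously to the closure of `Ω`. -/
def HasTraces {Y : Type*} [TopologicalSpace Y] (Ω : Set Plane) (f : Plane → Y) : Prop :=
  ∀ x ∈ closure Ω, ∃ y, Tendsto f (𝓝[Ω] x) (𝓝 y)

/-- The continuous extension of `f|_Ω` to the closure of `Ω`: on the boundary this is the trace
of `f` taken from inside `Ω`. Values of `f` outside `Ω` play no role. -/
def tr {Y : Type*} [TopologicalSpace Y] (Ω : Set Plane) (f : Plane → Y) : Plane → Y :=
  extendFrom Ω f

/-! ### Geometry of the periodic channel -/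

/-- `n` points out of `Ω` at the boundary point `x`, and `Ω` lies on the opposite side. -/
def IsOutward (Ω : Set Plane) (x n : Plane) : Prop :=
  ∀ᶠ z in 𝓝[>] (0 : ℝ), x - z • n ∈ Ω ∧ x + z • n ∉ closure Ω

/-- One period of a two-dimensional channel of period `L` that carries one particle.

The upper and lower walls are (one period of) the curves `xp`, `xm`, and the particle contour `γ`
is the closed curve `xc`; all three are simple `C¹` curves parametrized by arclength. The walls
are directed leftwards: they start, for `s = 0`, at the endpoints `z⁺ = (L,b)`, `z⁻ = (L,a)` of
the end section `Γ_L`, and reach the other end section `Γ₀` at `s = ℓp`, `s = ℓm`. -/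
structure Channel where
  /-- period of the channel -/
  L : ℝ
  /-- ordinate of the lower endpoints of the end sections -/
  a : ℝ
  /-- ordinate of the upper endpoints of the end sections -/
  b : ℝ
  /-- length of (one period of) the upper wall -/
  ℓp : ℝ
  /-- length of (one period of) the lower wall -/
  ℓm : ℝ
  /-- length of the particle contour -/
  ℓc : ℝ
  /-- upper wall (all periods) -/
  xp : ℝ → Plane
  /-- lower wall (all periods) -/
  xm : ℝ → Plane
  /-- particle contour -/
  xc : ℝ → Plane
  /-- fluid region in one period -/
  Ω : Set Plane
  L_pos : 0 < L
  a_lt_b : a < b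
  ℓp_pos : 0 < ℓp
  ℓm_pos : 0 < ℓm
  ℓc_pos : 0 < ℓc
  xp_contDiff : ContDiff ℝ 1 xp
  xm_contDiff : ContDiff ℝ 1 xm
  xc_contDiff : ContDiff ℝ 1 xc
  xp_unit : ∀ s, ‖deriv xp s‖ = 1
  xm_unit : ∀ s, ‖deriv xm s‖ = 1
  xc_unit : ∀ s, ‖deriv xc s‖ = 1
  xp_zero : xp 0 = !₂[L, b]
  xm_zero : xm 0 = !₂[L, a]
  xp_period : ∀ s, xp (s + ℓp) = xp s - L • e₁
  xm_period : ∀ s, xm (s + ℓm) = xm s - L • e₁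
  xc_period : ∀ s, xc (s + ℓc) = xc s
  /-- the three curves are simple -/
  xp_inj : Function.Injective xp
  xm_inj : Function.Injective xm
  xc_inj : InjOn xc (Ico 0 ℓc)
  /-- the two walls and the contour do not touch each other -/
  xp_ne_xm : ∀ s t, xp s ≠ xm t
  xc_ne_xp : ∀ s t, xc s ≠ xp t
  xc_ne_xm : ∀ s t, xc s ≠ xm t
  /-- the walls meet the end section `Γ_L` at its endpoints only -/
  xp_section : ∀ s, xp s 0 = L → xp s 1 ∈ Icc a b → s = 0
  xm_section : ∀ s, xm s 0 = L → xm s 1 ∈ Icc a b → s = 0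
  /-- the contour does not meet the end sections -/
  xc_section : ∀ s, (xc s 0 = 0 ∨ xc s 0 = L) → xc s 1 ∉ Icc a b
  Ω_open : IsOpen Ω
  Ω_connected : IsConnected Ω
  Ω_bounded : Bornology.IsBounded Ω
  /-- the boundary of `Ω` is `Γ⁺ ∪ Γ⁻ ∪ γ ∪ Γ₀ ∪ Γ_L` -/
  Ω_frontier : frontier Ω =
    xp '' Icc 0 ℓp ∪ xm '' Icc 0 ℓm ∪ range xc ∪
      {x | x 0 = 0 ∧ x 1 ∈ Icc a b} ∪ {x | x 0 = L ∧ x 1 ∈ Icc a b}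
  /-- the outward unit normals; on `Γ⁻` and `γ` the normal is `r · τ`, on `Γ⁺` it is `- r · τ` -/
  outward_p : ∀ s ∈ Ioo 0 ℓp, IsOutward Ω (xp s) (-rotate (deriv xp s))
  outward_m : ∀ s ∈ Ioo 0 ℓm, IsOutward Ω (xm s) (rotate (deriv xm s))
  outward_c : ∀ s, IsOutward Ω (xc s) (rotate (deriv xc s))
  outward_L : ∀ y ∈ Ioo a b, IsOutward Ω !₂[L, y] e₁
  outward_0 : ∀ y ∈ Ioo a b, IsOutward Ω !₂[0, y] (-e₁)

namespace Channel

variable (C : Channel)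

/-- Outward unit normal on the upper wall. -/
def np (s : ℝ) : Plane := -rotate (deriv C.xp s)

/-- Outward unit normal on the lower wall. -/
def nm (s : ℝ) : Plane := rotate (deriv C.xm s)

/-- Unit tangent on the particle contour. -/
def τc (s : ℝ) : Plane := deriv C.xc s

/-- Unit normal on the particle contour, outward to the fluid region. -/
def nc (s : ℝ) : Plane := rotate (C.τc s)

/-- The fluid region of the whole (infinite) periodic channel: the union of all translates by
multiples of the period of `Ω` and of the open end section `Γ_L`. -/
def whole : Set Plane :=
  {x | ∃ k : ℤ, ∃ y ∈ C.Ω ∪ {y : Plane | y 0 = C.L ∧ y 1 ∈ Ioo C.a C.b},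
    x = y + ((k : ℝ) * C.L) • e₁}

/-- `∫_{Γ ∪ γ} n · A · ζ ds` for a tensor field `A` and a vector field `ζ`. -/
def boundaryIntegral (A : Plane → Matrix (Fin 2) (Fin 2) ℝ) (ζ : Plane → Plane) : ℝ :=
  (∫ s in (0 : ℝ)..C.ℓp, (C.np s).ofLp ⬝ᵥ (A (C.xp s) *ᵥ (ζ (C.xp s)).ofLp))
    + (∫ s in (0 : ℝ)..C.ℓm, (C.nm s).ofLp ⬝ᵥ (A (C.xm s) *ᵥ (ζ (C.xm s)).ofLp))
    + ∫ s in (0 : ℝ)..C.ℓc, (C.nc s).ofLp ⬝ᵥ (A (C.xc s) *ᵥ (ζ (C.xc s)).ofLp)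

/-- The jump `Δq(x₂) = q(L,x₂) - q(0,x₂)`, with the values on the end sections taken from
inside `Ω`. -/
def jump (q : Plane → ℝ) (y : ℝ) : ℝ := tr C.Ω q !₂[C.L, y] - tr C.Ω q !₂[0, y]

/-- `(u,p)` is a classical solution of the Stokes equations `div u = 0`, `-Δu + ∇p = 0` in `Ω`;
moreover `u`, `∇u` and `p` extend continuously to the closure of `Ω`. -/
structure IsStokes (u : Plane → Plane) (p : Plane → ℝ) : Prop where
  u_contDiff : ContDiffOn ℝ 2 u C.Ω
  p_contDiff : ContDiffOn ℝ 1 p C.Ω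
  u_trace : HasTraces C.Ω u
  grad_trace : HasTraces C.Ω (grad u)
  p_trace : HasTraces C.Ω p
  incompressible : ∀ x ∈ C.Ω, div u x = 0
  momentum : ∀ x ∈ C.Ω, -(Laplacian.laplacian u x) + gradient p x = 0

/-- `u` is a periodic velocity field: periodic and `C¹` in the whole channel. -/
structure IsPeriodicVelocity (u : Plane → Plane) : Prop where
  contDiff : ContDiffOn ℝ 1 u C.whole
  periodic : ∀ x ∈ C.whole, u (x + C.L • e₁) = u x

/-- `p` is a periodic pressure field: periodic and continuous in the whole channel. -/
structure IsPeriodicPressure (p : Plane → ℝ) : Prop where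
  continuousOn : ContinuousOn p C.whole
  periodic : ∀ x ∈ C.whole, p (x + C.L • e₁) = p x

/-- The trace of `u` on `γ` is the rigid-body velocity `w + ϱ r · x`. -/
def HasRigidTrace (u : Plane → Plane) (w : Plane) (ϱ : ℝ) : Prop :=
  ∀ s, tr C.Ω u (C.xc s) = w + ϱ • rotate (C.xc s)

/-- The stress vector `σ[u,p] · n` on `γ`. -/
def traction (u : Plane → Plane) (p : Plane → ℝ) (s : ℝ) : Fin 2 → ℝ :=
  tr C.Ω (stress u p) (C.xc s) *ᵥ (C.nc s).ofLp

/-- The tangential component `h_s = τ · σ[u,p] · n` of the stress vector on `γ`. -/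
def tangentialTraction (u : Plane → Plane) (p : Plane → ℝ) (s : ℝ) : ℝ :=
  (C.τc s).ofLp ⬝ᵥ C.traction u p s

/-- `C¹` vector fields on `Ωall` that vanish near its boundary (extended by zero to the plane),
are periodic across the end sections and have no axial component there. -/
structure IsTestField (Ωall : Set Plane) (ζ : Plane → Plane) : Prop where
  contDiff : ContDiff ℝ 1 ζ
  support : tsupport ζ ⊆ Ωall
  periodic : ∀ y ∈ Icc C.a C.b, ζ !₂[0, y] = ζ !₂[C.L, y]
  axial : ∀ y ∈ Icc C.a C.b, ζ !₂[0, y] 0 = 0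

end Channel

end StokesChannel

end

/-!
The integral identity is the divergence theorem for the field `E · ζ`. By the Stokes equations `E` is
divergence free in the fluid: `E` is bilinear in the two flows, and the terms in which the first (or
the second) flow is differentiated cancel among themselves (`sum_pointE_eq_zero`). Hence
`div (E · ζ) = E : ∇ᵀζ`. On the end sections only the component `E₁₂` enters, because `ζ₁ = 0` there.
The traces of `∇u`, `∇v` and `p` on the two sections agree by periodicity, so the difference of the
two fluxes is the integral of `Δq (∂₂u₁) ζ₂`.

The field is only continuous up to the boundary, and the boundary is only piecewise `C¹`, possibly
with cusps where the walls reach the end sections. The divergence theorem in this generality is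
`IsPiecewiseBoundary.integral_div`. Near a regular boundary point one uses the coordinates
`(s, t) ↦ c(s) - t N`, with `N` the normal at the point: the Jacobian `c'(s) × N` depends on `s` alone,
and `J div G = ∂ₛ (G × N) + ∂ₜ (G × c')`, where each term needs no more than a `C¹` arc. Integrating
over `t ≥ δ` and letting `δ → 0` handles fields that are merely continuous at the boundary
(`integral_div_image_tube`). That the side `t > 0` is fluid and the side `t < 0` is not follows from
connectedness (`exists_tube_box`). A partition of unity globalizes this, and the finitely many
endpoints of arcs are removed by cutoffs, whose gradients are of order `1 / r` on sets of area of
order `r²`.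

For the formula on the contour, the fundamental theorem of calculus along curves parallel to the
contour shows that a rigid trace can be differentiated along it, so that `∇u · τ = ϱ n`
(`IsStokes.grad_mulVec_tangent`). With `div u = 0` this leaves one unknown `β` in
`∇u = β τ ⊗ n + ϱ n ⊗ τ`. The tangential traction is then `β + ϱ`, and the formula is algebra in the
frame `(n, τ)`.
-/

noncomputable section

namespace StokesChannel

open MeasureTheory

/-! ### Tube coordinates and change of variables -/

/-- The cross product `a × b = a₁ b₂ - a₂ b₁`, equal to `(r · a) · b`. -/
def cross (a b : Plane) : ℝ := a 0 * b 1 - a 1 * b 0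

/-- The map `(s, t) ↦ c(s) - t N`, which coordinatizes a neighbourhood of a regular curve `c` when
the constant vector `N` is transversal to it. -/
def tube (c : ℝ → Plane) (N : Plane) (z : ℝ × ℝ) : Plane := c z.1 - z.2 • N

lemma rotate_zero (a : Plane) : rotate a 0 = -a 1 := by
  simp [rotate, rot, dotProduct, Fin.sum_univ_two]

lemma rotate_one (a : Plane) : rotate a 1 = a 0 := by
  simp [rotate, rot, dotProduct, Fin.sum_univ_two]

lemma cross_add_right (a b b' : Plane) : cross a (b + b') = cross a b + cross a b' := by
  simp [cross]; ring

lemma cross_smul_right (a b : Plane) (t : ℝ) : cross a (t • b) = t * cross a b := by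
  simp [cross]; ring

lemma continuous_cross : Continuous fun z : Plane × Plane => cross z.1 z.2 := by
  unfold cross; fun_prop

lemma basis_expand (a : Plane) :
    a = a 0 • EuclideanSpace.single (0 : Fin 2) (1 : ℝ)
      + a 1 • EuclideanSpace.single (1 : Fin 2) (1 : ℝ) := by
  ext i; fin_cases i <;> simp

lemma div_eq (G : Plane → Plane) (x : Plane) :
    div G x = fderiv ℝ G x (EuclideanSpace.single 0 1) 0
      + fderiv ℝ G x (EuclideanSpace.single 1 1) 1 := by
  simp [div, grad, Matrix.trace, Fin.sum_univ_two]

/-- For a linear map `M` of the plane, `Ma × b + a × Mb = (tr M) (a × b)`. This is what turns the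
divergence into a sum of two derivatives in tube coordinates. -/
lemma cross_fderiv (G : Plane → Plane) (x a b : Plane) :
    cross (fderiv ℝ G x a) b + cross a (fderiv ℝ G x b) = div G x * cross a b := by
  rw [div_eq]
  set M := fderiv ℝ G x
  have ha : M a = a 0 • M (EuclideanSpace.single 0 1) + a 1 • M (EuclideanSpace.single 1 1) := by
    conv_lhs => rw [basis_expand a]
    simp
  have hb : M b = b 0 • M (EuclideanSpace.single 0 1) + b 1 • M (EuclideanSpace.single 1 1) := by
    conv_lhs => rw [basis_expand b]
    simp
  rw [ha, hb]
  simp [cross]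
  ring

/-- The coordinate equivalence of the plane with `ℝ × ℝ`. -/
def planeEquiv : Plane ≃L[ℝ] ℝ × ℝ :=
  (EuclideanSpace.equiv (Fin 2) ℝ).trans (ContinuousLinearEquiv.finTwoArrow ℝ ℝ)

lemma planeEquiv_apply (x : Plane) : planeEquiv x = (x 0, x 1) := rfl

lemma measurePreserving_planeEquiv : MeasurePreserving (planeEquiv : Plane → ℝ × ℝ) :=
  (volume_preserving_finTwoArrow ℝ).comp (PiLp.volume_preserving_ofLp (Fin 2))

lemma measurableEmbedding_planeEquiv : MeasurableEmbedding (planeEquiv : Plane → ℝ × ℝ) :=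
  planeEquiv.toHomeomorph.measurableEmbedding

/-- The derivative `(σ, θ) ↦ σ c'(s) - θ N` of `tube c N` at `z = (s, t)`. -/
def tubeDeriv (c : ℝ → Plane) (N : Plane) (z : ℝ × ℝ) : ℝ × ℝ →L[ℝ] Plane :=
  (ContinuousLinearMap.fst ℝ ℝ ℝ).smulRight (deriv c z.1)
    - (ContinuousLinearMap.snd ℝ ℝ ℝ).smulRight N

lemma hasStrictFDerivAt_tube {c : ℝ → Plane} (hc : ContDiff ℝ 1 c) (N : Plane) (z : ℝ × ℝ) :
    HasStrictFDerivAt (tube c N) (tubeDeriv c N z) z := by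
  have h1 : HasStrictDerivAt c (deriv c z.1) z.1 :=
    (hc.contDiffAt).hasStrictDerivAt (by norm_num)
  have h2 := h1.hasStrictFDerivAt.comp z (hasStrictFDerivAt_fst (𝕜 := ℝ) (p := z))
  have h3 := (hasStrictFDerivAt_snd (𝕜 := ℝ) (p := z)).smul_const N
  have := h2.sub h3
  refine this.congr_fderiv ?_
  ext <;> simp [tubeDeriv]

lemma det_tubeDeriv (c : ℝ → Plane) (N : Plane) (z : ℝ × ℝ) :
    ((planeEquiv : Plane →L[ℝ] ℝ × ℝ).comp (tubeDeriv c N z)).det = -cross (deriv c z.1) N := by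
  rw [ContinuousLinearMap.det, ← LinearMap.det_toMatrix (Module.Basis.finTwoProd ℝ),
    Matrix.det_fin_two]
  simp [LinearMap.toMatrix_apply, planeEquiv_apply, tubeDeriv, cross]
  ring

lemma setIntegral_image_tube {c : ℝ → Plane} (hc : ContDiff ℝ 1 c) (N : Plane) {S : Set (ℝ × ℝ)}
    (hS : MeasurableSet S) (hinj : InjOn (tube c N) S) (f : Plane → ℝ) :
    ∫ x in tube c N '' S, f x
      = ∫ z in S, |cross (deriv c z.1) N| * f (tube c N z) := by
  have h := integral_image_eq_integral_abs_det_fderiv_smul (volume : Measure (ℝ × ℝ)) hS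
    (f := fun z => planeEquiv (tube c N z))
    (f' := fun z => (planeEquiv : Plane →L[ℝ] ℝ × ℝ).comp (tubeDeriv c N z))
    (fun z _ => ((planeEquiv : Plane →L[ℝ] ℝ × ℝ).hasFDerivAt.comp z
      (hasStrictFDerivAt_tube hc N z).hasFDerivAt).hasFDerivWithinAt)
    (fun z hz w hw h => hinj hz hw (planeEquiv.injective h)) (fun y => f (planeEquiv.symm y))
  simp only [det_tubeDeriv, abs_neg, ContinuousLinearEquiv.symm_apply_apply, smul_eq_mul] at h
  rw [← h, ← image_image (fun x => planeEquiv x) (tube c N) S,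
    measurePreserving_planeEquiv.setIntegral_image_emb measurableEmbedding_planeEquiv]
  simp

lemma integrableOn_image_tube {c : ℝ → Plane} (hc : ContDiff ℝ 1 c) (N : Plane) {S : Set (ℝ × ℝ)}
    (hS : MeasurableSet S) (hinj : InjOn (tube c N) S) (f : Plane → ℝ) :
    IntegrableOn f (tube c N '' S) ↔
      IntegrableOn (fun z => |cross (deriv c z.1) N| * f (tube c N z)) S := by
  have h := integrableOn_image_iff_integrableOn_abs_det_fderiv_smul (volume : Measure (ℝ × ℝ)) hS
    (f := fun z => planeEquiv (tube c N z))
    (f' := fun z => (planeEquiv : Plane →L[ℝ] ℝ × ℝ).comp (tubeDeriv c N z))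
    (fun z _ => ((planeEquiv : Plane →L[ℝ] ℝ × ℝ).hasFDerivAt.comp z
      (hasStrictFDerivAt_tube hc N z).hasFDerivAt).hasFDerivWithinAt)
    (fun z hz w hw h => hinj hz hw (planeEquiv.injective h)) (fun y => f (planeEquiv.symm y))
  simp only [det_tubeDeriv, abs_neg, ContinuousLinearEquiv.symm_apply_apply, smul_eq_mul] at h
  rw [← h, ← image_image (fun x => planeEquiv x) (tube c N) S,
    measurePreserving_planeEquiv.integrableOn_image measurableEmbedding_planeEquiv]
  simp [Function.comp_def]

/-! ### The divergence theorem on a box in tube coordinates -/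

/-- The divergence theorem on a rectangle for two scalar components, each differentiated along its
own axis only, when only the edge `t = δ` contributes. -/
lemma integral_rectangle {a b δ d : ℝ} (hab : a ≤ b) (hδd : δ ≤ d) {H₁ H₂ h₁ h₂ : ℝ × ℝ → ℝ}
    (d₁ : ∀ s ∈ Icc a b, ∀ t ∈ Icc δ d, HasDerivAt (fun s => H₁ (s, t)) (h₁ (s, t)) s)
    (d₂ : ∀ s ∈ Icc a b, ∀ t ∈ Icc δ d, HasDerivAt (fun t => H₂ (s, t)) (h₂ (s, t)) t)
    (c₁ : ContinuousOn h₁ (Icc a b ×ˢ Icc δ d)) (c₂ : ContinuousOn h₂ (Icc a b ×ˢ Icc δ d))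
    (za : ∀ t ∈ Icc δ d, H₁ (a, t) = 0) (zb : ∀ t ∈ Icc δ d, H₁ (b, t) = 0)
    (zd : ∀ s ∈ Icc a b, H₂ (s, d) = 0) :
    ∫ z in Icc a b ×ˢ Icc δ d, (h₁ z + h₂ z) = -∫ s in a..b, H₂ (s, δ) := by
  have hK : IsCompact (Icc a b ×ˢ Icc δ d) := isCompact_Icc.prod isCompact_Icc
  have i₁ := c₁.integrableOn_compact (μ := (volume : Measure (ℝ × ℝ))) hK
  have i₂ := c₂.integrableOn_compact (μ := (volume : Measure (ℝ × ℝ))) hK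
  rw [integral_add i₁ i₂]
  have e₁ : ∫ z in Icc a b ×ˢ Icc δ d, h₁ z = 0 := by
    have hsw : IntegrableOn (fun z : ℝ × ℝ => h₁ z.swap) (Icc δ d ×ˢ Icc a b)
        (volume : Measure (ℝ × ℝ)) := by
      have : ContinuousOn (fun z : ℝ × ℝ => h₁ z.swap) (Icc δ d ×ˢ Icc a b) :=
        c₁.comp continuous_swap.continuousOn fun z hz => ⟨hz.2, hz.1⟩
      exact this.integrableOn_compact (isCompact_Icc.prod isCompact_Icc)
    have := setIntegral_prod_swap (μ := (volume : Measure ℝ)) (ν := (volume : Measure ℝ))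
      (Icc a b) (Icc δ d) h₁
    rw [Measure.volume_eq_prod, ← this, setIntegral_prod _ hsw]
    refine setIntegral_eq_zero_of_forall_eq_zero fun t ht => ?_
    have hcont : ContinuousOn (fun s => h₁ (s, t)) (Icc a b) :=
      c₁.comp (by fun_prop) fun s hs => ⟨hs, ht⟩
    have := intervalIntegral.integral_eq_sub_of_hasDerivAt (a := a) (b := b)
      (f := fun s => H₁ (s, t)) (f' := fun s => h₁ (s, t))
      (fun s hs => d₁ s (by rwa [uIcc_of_le hab] at hs) t ht)
      (ContinuousOn.intervalIntegrable (by rwa [uIcc_of_le hab]))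
    rw [za t ht, zb t ht, sub_zero, intervalIntegral.integral_of_le hab,
      ← integral_Icc_eq_integral_Ioc] at this
    exact this
  have e₂ : ∫ z in Icc a b ×ˢ Icc δ d, h₂ z = -∫ s in a..b, H₂ (s, δ) := by
    rw [Measure.volume_eq_prod, setIntegral_prod _ i₂, intervalIntegral.integral_of_le hab,
      ← integral_Icc_eq_integral_Ioc, ← integral_neg]
    refine setIntegral_congr_fun measurableSet_Icc fun s hs => ?_
    have hcont : ContinuousOn (fun t => h₂ (s, t)) (Icc δ d) :=
      c₂.comp (by fun_prop) fun t ht => ⟨hs, ht⟩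
    have := intervalIntegral.integral_eq_sub_of_hasDerivAt (a := δ) (b := d)
      (f := fun t => H₂ (s, t)) (f' := fun t => h₂ (s, t))
      (fun t ht => d₂ s hs t (by rwa [uIcc_of_le hδd] at ht))
      (ContinuousOn.intervalIntegrable (by rwa [uIcc_of_le hδd]))
    rw [zd s hs, zero_sub, intervalIntegral.integral_of_le hδd,
      ← integral_Icc_eq_integral_Ioc] at this
    exact this
  rw [e₁, e₂, zero_add]

lemma continuous_tube {c : ℝ → Plane} (hc : Continuous c) (N : Plane) : Continuous (tube c N) := by
  unfold tube; fun_prop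

lemma tendsto_tube {c : ℝ → Plane} (hc : Continuous c) (N : Plane) (s : ℝ) {l : Filter ℝ}
    (hl : l ≤ 𝓝 0) : Tendsto (fun t => tube c N (s, t)) l (𝓝 (c s)) := by
  have : Continuous fun t => tube c N (s, t) := by unfold tube; fun_prop
  simpa [tube] using (this.tendsto 0).mono_left hl

/-- The divergence theorem on the image of a box under tube coordinates, when the field vanishes on
the three edges other than the arc `c`. Up to the arc the field need only be continuous: the
identity is first proved on `t ≥ δ > 0`. Since the Jacobian depends on `s` alone, each component is
only differentiated along the variable in which it is differentiable, and a `C¹` arc suffices. -/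
lemma integral_div_image_tube {Ω : Set Plane} (hΩ : IsOpen Ω) {G : Plane → Plane}
    (hG : ContinuousOn G (closure Ω)) (hG' : ContDiffOn ℝ 1 G Ω) (hdiv : IntegrableOn (div G) Ω)
    {c : ℝ → Plane} (hc : ContDiff ℝ 1 c) {N : Plane} {a b d : ℝ} (hab : a ≤ b) (hd : 0 < d)
    (hmap : ∀ s ∈ Icc a b, ∀ t ∈ Ioc 0 d, tube c N (s, t) ∈ Ω)
    (hinj : InjOn (tube c N) (Icc a b ×ˢ Ioc 0 d))
    (hJ : ∀ s ∈ Icc a b, 0 < cross (deriv c s) N)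
    (hsa : ∀ t ∈ Ioc 0 d, G (tube c N (a, t)) = 0) (hsb : ∀ t ∈ Ioc 0 d, G (tube c N (b, t)) = 0)
    (htop : ∀ s ∈ Icc a b, G (tube c N (s, d)) = 0) :
    ∫ x in tube c N '' (Icc a b ×ˢ Ioc 0 d), div G x
      = ∫ s in a..b, cross (deriv c s) (G (c s)) := by
  have hSm : MeasurableSet (Icc a b ×ˢ Ioc 0 d) := measurableSet_Icc.prod measurableSet_Ioc
  have hsub : tube c N '' (Icc a b ×ˢ Ioc 0 d) ⊆ Ω := by
    rintro _ ⟨⟨s, t⟩, ⟨hs, ht⟩, rfl⟩; exact hmap s hs t ht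
  have hc' : Continuous (deriv c) := hc.continuous_deriv (by norm_num)
  have hclos : ∀ s ∈ Icc a b, ∀ t ∈ Icc 0 d, tube c N (s, t) ∈ closure Ω := by
    intro s hs t ht
    rcases ht.1.eq_or_lt with h0 | h0
    · subst h0
      refine mem_closure_of_tendsto (b := 𝓝[>] (0 : ℝ)) (f := fun t => tube c N (s, t)) ?_ ?_
      · simpa [tube] using tendsto_tube hc.continuous N s nhdsWithin_le_nhds
      · filter_upwards [Ioc_mem_nhdsGT hd] with t ht using hmap s hs t ht
    · exact subset_closure (hmap s hs t ⟨h0, ht.2⟩)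
  have hGt : ContinuousOn (fun z => G (tube c N z)) (Icc a b ×ˢ Icc 0 d) :=
    hG.comp (continuous_tube hc.continuous N).continuousOn fun z hz => hclos z.1 hz.1 z.2 hz.2
  have hdG : ContinuousOn (fderiv ℝ G) Ω := hG'.continuousOn_fderiv_of_isOpen hΩ le_rfl
  have hdiff : ∀ x ∈ Ω, HasFDerivAt G (fderiv ℝ G x) x := fun x hx =>
    ((hG'.differentiableOn one_ne_zero).differentiableAt (hΩ.mem_nhds hx)).hasFDerivAt
  -- the integrand in tube coordinates
  set f : ℝ × ℝ → ℝ := fun z => cross (deriv c z.1) N * div G (tube c N z) with hf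
  have habs : EqOn (fun z : ℝ × ℝ => |cross (deriv c z.1) N| * div G (tube c N z)) f
      (Icc a b ×ˢ Ioc 0 d) := fun z hz => by simp only [hf, abs_of_pos (hJ z.1 hz.1)]
  rw [setIntegral_image_tube hc N hSm hinj, setIntegral_congr_fun hSm habs]
  have hfi : IntegrableOn f (Icc a b ×ˢ Ioc 0 d) :=
    ((integrableOn_image_tube hc N hSm hinj _).1 (hdiv.mono_set hsub)).congr_fun habs hSm
  -- the identity on the box `[a, b] × [δ, d]`
  have key : ∀ δ, 0 < δ → δ ≤ d → ∫ z in Icc a b ×ˢ Icc δ d, f z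
      = ∫ s in a..b, cross (deriv c s) (G (tube c N (s, δ))) := by
    intro δ hδ hδd
    have hbox : ∀ s ∈ Icc a b, ∀ t ∈ Icc δ d, tube c N (s, t) ∈ Ω := fun s hs t ht =>
      hmap s hs t ⟨hδ.trans_le ht.1, ht.2⟩
    have hcD : ∀ g : ℝ × ℝ → Plane, Continuous g →
        ContinuousOn (fun z => fderiv ℝ G (tube c N z) (g z)) (Icc a b ×ˢ Icc δ d) := by
      intro g hg
      exact (hdG.comp (continuous_tube hc.continuous N).continuousOn
        fun z hz => hbox z.1 hz.1 z.2 hz.2).clm_apply hg.continuousOn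
    have := integral_rectangle hab hδd
      (H₁ := fun z => cross (G (tube c N z)) N)
      (H₂ := fun z => -cross (deriv c z.1) (G (tube c N z)))
      (h₁ := fun z => cross (fderiv ℝ G (tube c N z) (deriv c z.1)) N)
      (h₂ := fun z => cross (deriv c z.1) (fderiv ℝ G (tube c N z) N)) ?_ ?_ ?_ ?_ ?_ ?_ ?_
    · rw [intervalIntegral.integral_neg, neg_neg] at this
      rw [← this]
      refine setIntegral_congr_fun (measurableSet_Icc.prod measurableSet_Icc) fun z _ => ?_
      simp only [hf]
      rw [cross_fderiv, mul_comm]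
    · intro s hs t ht
      have h1 : HasDerivAt (fun s => tube c N (s, t)) (deriv c s) s :=
        ((hc.differentiable one_ne_zero s).hasDerivAt).sub_const (t • N)
      have h2 := (hdiff _ (hbox s hs t ht)).comp_hasDerivAt s h1
      have h20 := (hasDerivAt_pi.1 ((PiLp.hasFDerivAt_ofLp 2 _).comp_hasDerivAt s h2))
      exact ((h20 0).mul_const (N 1)).sub ((h20 1).mul_const (N 0))
    · intro s hs t ht
      have h1 : HasDerivAt (fun t => tube c N (s, t)) (-N) t := by
        simpa [tube] using ((hasDerivAt_id t).smul_const N).const_sub (c s)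
      have h2 := (hdiff _ (hbox s hs t ht)).comp_hasDerivAt t h1
      have h20 := (hasDerivAt_pi.1 ((PiLp.hasFDerivAt_ofLp 2 _).comp_hasDerivAt t h2))
      have := (((h20 1).const_mul (deriv c s 0)).sub ((h20 0).const_mul (deriv c s 1))).neg
      refine this.congr_deriv ?_
      simp [cross]; ring
    · exact continuous_cross.comp_continuousOn
        ((hcD _ (hc'.comp continuous_fst)).prodMk continuousOn_const)
    · exact continuous_cross.comp_continuousOn
        ((hc'.comp continuous_fst).continuousOn.prodMk (hcD _ continuous_const))
    · intro t ht; simp [hsa t ⟨hδ.trans_le ht.1, ht.2⟩, cross]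
    · intro t ht; simp [hsb t ⟨hδ.trans_le ht.1, ht.2⟩, cross]
    · intro s hs; simp [htop s hs, cross]
  -- exhaust the half-open box
  set δ : ℕ → ℝ := fun n => d / (n + 1) with hδdef
  have hδ0 : Tendsto δ atTop (𝓝 0) := by
    simpa [hδdef, div_eq_mul_inv] using (tendsto_one_div_add_atTop_nhds_zero_nat (𝕜 := ℝ)).const_mul d
  have hδpos : ∀ n, 0 < δ n := fun n => by simp only [hδdef]; positivity
  have hδle : ∀ n, δ n ≤ d := fun n => by
    simp only [hδdef]; exact div_le_self hd.le (by simp)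
  have hunion : ⋃ n, Icc a b ×ˢ Icc (δ n) d = Icc a b ×ˢ Ioc 0 d := by
    ext ⟨s, t⟩
    simp only [mem_iUnion, mem_prod]
    constructor
    · rintro ⟨n, hs, ht⟩; exact ⟨hs, (hδpos n).trans_le ht.1, ht.2⟩
    · rintro ⟨hs, ht⟩
      obtain ⟨n, hn⟩ := (hδ0.eventually (gt_mem_nhds ht.1)).exists
      exact ⟨n, hs, hn.le, ht.2⟩
  have lim1 := tendsto_setIntegral_of_monotone (μ := (volume : Measure (ℝ × ℝ)))
    (s := fun n => Icc a b ×ˢ Icc (δ n) d) (f := f)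
    (fun n => measurableSet_Icc.prod measurableSet_Icc)
    (fun m n hmn => prod_mono_right (Icc_subset_Icc_left (by
      simp only [hδdef]; gcongr))) (by rwa [hunion])
  rw [hunion] at lim1
  refine tendsto_nhds_unique lim1 ?_
  simp_rw [key _ (hδpos _) (hδle _)]
  have hI : ContinuousOn (fun z : ℝ × ℝ => cross (deriv c z.1) (G (tube c N z)))
      (Icc a b ×ˢ Icc 0 d) :=
    continuous_cross.comp_continuousOn ((hc'.comp continuous_fst).continuousOn.prodMk hGt)
  obtain ⟨M, hM⟩ := (isCompact_Icc.prod isCompact_Icc).exists_bound_of_continuousOn hI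
  have hcol : ∀ t ∈ Icc 0 d, ContinuousOn
      (fun s => cross (deriv c s) (G (tube c N (s, t)))) (Icc a b) := fun t ht =>
    hI.comp (f := fun s : ℝ => (s, t)) (by fun_prop) fun s hs => ⟨hs, ht⟩
  refine intervalIntegral.tendsto_integral_filter_of_dominated_convergence (fun _ => M) ?_ ?_ ?_ ?_
  · refine Eventually.of_forall fun n => ?_
    rw [uIoc_of_le hab]
    exact ((hcol _ ⟨(hδpos n).le, hδle n⟩).mono Ioc_subset_Icc_self).aestronglyMeasurable
      measurableSet_Ioc
  · refine Eventually.of_forall fun n => Eventually.of_forall fun s hs => ?_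
    rw [uIoc_of_le hab] at hs
    exact hM (s, δ n) ⟨Ioc_subset_Icc_self hs, (hδpos n).le, hδle n⟩
  · exact intervalIntegrable_const
  · refine Eventually.of_forall fun s hs => ?_
    rw [uIoc_of_le hab] at hs
    have hs' := Ioc_subset_Icc_self hs
    have h1 := (hI (s, 0) ⟨hs', le_rfl, hd.le⟩)
    have h2 : Tendsto (fun n => (s, δ n)) atTop (𝓝[Icc a b ×ˢ Icc 0 d] (s, 0)) :=
      tendsto_nhdsWithin_iff.2 ⟨tendsto_const_nhds.prodMk_nhds hδ0,
        Eventually.of_forall fun n => ⟨hs', (hδpos n).le, hδle n⟩⟩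
    simpa [tube, Function.comp_def] using h1.tendsto.comp h2

/-! ### One-sidedness of the domain near a regular boundary point -/

/-- The open box of half-width `η` around `(s₀, 0)`. -/
def box (s₀ η : ℝ) : Set (ℝ × ℝ) := Ioo (s₀ - η) (s₀ + η) ×ˢ Ioo (-η) η

lemma mem_box {s₀ η : ℝ} {z : ℝ × ℝ} :
    z ∈ box s₀ η ↔ (s₀ - η < z.1 ∧ z.1 < s₀ + η) ∧ -η < z.2 ∧ z.2 < η := by
  simp [box]

lemma isOpen_box (s₀ η : ℝ) : IsOpen (box s₀ η) := isOpen_Ioo.prod isOpen_Ioo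

lemma center_mem_box (s₀ : ℝ) {η : ℝ} (hη : 0 < η) : (s₀, (0 : ℝ)) ∈ box s₀ η := by
  simp [mem_box, hη]

lemma box_mono (s₀ : ℝ) {η η' : ℝ} (h : η ≤ η') : box s₀ η ⊆ box s₀ η' := fun z hz => by
  rw [mem_box] at hz ⊢
  constructor <;> constructor <;> linarith [hz.1.1, hz.1.2, hz.2.1, hz.2.2]

lemma exists_box_of_eventually {s₀ : ℝ} {P : ℝ × ℝ → Prop} (h : ∀ᶠ z in 𝓝 (s₀, (0 : ℝ)), P z) :
    ∃ η, 0 < η ∧ ∀ z ∈ box s₀ η, P z := by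
  obtain ⟨η, hη, h⟩ := Metric.eventually_nhds_iff_ball.1 h
  refine ⟨η, hη, fun z hz => h z ?_⟩
  rw [← ball_prod_same, Real.ball_eq_Ioo, Real.ball_eq_Ioo]
  simpa [box] using hz

lemma cross_rotate_self_pos {v : Plane} (hv : v ≠ 0) : 0 < cross v (rotate v) := by
  rw [cross, rotate_zero, rotate_one]
  have : v 0 ≠ 0 ∨ v 1 ≠ 0 := by
    by_contra! h
    exact hv (by ext i; fin_cases i <;> simp [h.1, h.2])
  rcases this with h | h
  · nlinarith [sq_pos_of_ne_zero h, sq_nonneg (v 1)]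
  · nlinarith [sq_pos_of_ne_zero h, sq_nonneg (v 0)]

lemma exists_equiv_tubeDeriv {c : ℝ → Plane} {N : Plane} {z : ℝ × ℝ}
    (h : cross (deriv c z.1) N ≠ 0) :
    ∃ e : (ℝ × ℝ) ≃L[ℝ] Plane, (e : ℝ × ℝ →L[ℝ] Plane) = tubeDeriv c N z := by
  have hdet : ((planeEquiv : Plane →L[ℝ] ℝ × ℝ).comp (tubeDeriv c N z)).det ≠ 0 := by
    rw [det_tubeDeriv]; simpa using h
  refine ⟨(ContinuousLinearMap.toContinuousLinearEquivOfDetNeZero _ hdet).trans planeEquiv.symm,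
    ContinuousLinearMap.ext fun w => by simp⟩

lemma isOpen_image_tube {c : ℝ → Plane} (hc : ContDiff ℝ 1 c) {N : Plane} {S : Set (ℝ × ℝ)}
    (hS : IsOpen S) (h : ∀ z ∈ S, cross (deriv c z.1) N ≠ 0) : IsOpen (tube c N '' S) := by
  rw [isOpen_iff_mem_nhds]
  rintro _ ⟨z, hz, rfl⟩
  obtain ⟨e, he⟩ := exists_equiv_tubeDeriv (h z hz)
  have := hasStrictFDerivAt_tube hc N z
  rw [← he] at this
  rw [← this.map_nhds_eq_of_equiv]
  exact image_mem_map (hS.mem_nhds hz)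

lemma exists_injOn_tube {c : ℝ → Plane} (hc : ContDiff ℝ 1 c) {N : Plane} {s₀ : ℝ}
    (h : 0 < cross (deriv c s₀) N) :
    ∃ η, 0 < η ∧ InjOn (tube c N) (box s₀ η) ∧ ∀ z ∈ box s₀ η, 0 < cross (deriv c z.1) N := by
  obtain ⟨e, he⟩ := exists_equiv_tubeDeriv (z := (s₀, 0)) h.ne'
  have hst := hasStrictFDerivAt_tube hc N (s₀, 0)
  rw [← he] at hst
  have h1 : ∀ᶠ z in 𝓝 (s₀, (0 : ℝ)), z ∈ (hst.toOpenPartialHomeomorph (tube c N)).source :=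
    (hst.toOpenPartialHomeomorph _).open_source.mem_nhds hst.mem_toOpenPartialHomeomorph_source
  have hcont : Continuous fun z : ℝ × ℝ => cross (deriv c z.1) N :=
    continuous_cross.comp
      (((hc.continuous_deriv (by norm_num)).comp continuous_fst).prodMk continuous_const)
  have h2 : ∀ᶠ z in 𝓝 (s₀, (0 : ℝ)), 0 < cross (deriv c z.1) N :=
    hcont.continuousAt.eventually (lt_mem_nhds h)
  obtain ⟨η, hη, H⟩ := exists_box_of_eventually (h1.and h2)
  exact ⟨η, hη, (hst.toOpenPartialHomeomorph (tube c N)).injOn.mono fun z hz => (H z hz).1,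
    fun z hz => (H z hz).2⟩

lemma subset_or_of_disjoint_frontier {X : Type*} [TopologicalSpace X] {Ω S : Set X}
    (hΩ : IsOpen Ω) (hS : IsPreconnected S) (h : ∀ x ∈ S, x ∉ frontier Ω) :
    S ⊆ Ω ∨ S ⊆ (closure Ω)ᶜ := by
  refine hS.subset_or_subset hΩ isClosed_closure.isOpen_compl
    (disjoint_compl_right.mono_left subset_closure) fun x hx => ?_
  by_cases h' : x ∈ closure Ω
  · left
    by_contra h''
    exact h x hx (hΩ.frontier_eq ▸ ⟨h', h''⟩)
  · exact Or.inr h'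

/-- Near a regular point of a boundary arc at which the normal `r · c'` points outwards, the sides
`t > 0` and `t < 0` of the arc in tube coordinates are inside and outside `Ω`, uniformly along the
arc: each half box is connected and misses the frontier, so one point decides. -/
lemma exists_tube_box {Ω : Set Plane} (hΩ : IsOpen Ω) {c : ℝ → Plane} (hc : ContDiff ℝ 1 c) {s₀ : ℝ}
    (hreg : deriv c s₀ ≠ 0) (hout : IsOutward Ω (c s₀) (rotate (deriv c s₀)))
    (hfr : ∀ η > 0, ∀ᶠ x in 𝓝 (c s₀), x ∈ frontier Ω → x ∈ c '' Ioo (s₀ - η) (s₀ + η))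
    {ε : ℝ} (hε : 0 < ε) :
    ∃ η, 0 < η ∧ η ≤ ε ∧ InjOn (tube c (rotate (deriv c s₀))) (box s₀ η) ∧
      (∀ z ∈ box s₀ η, 0 < cross (deriv c z.1) (rotate (deriv c s₀))) ∧
      (∀ z ∈ box s₀ η, 0 < z.2 → tube c (rotate (deriv c s₀)) z ∈ Ω) ∧
      (∀ z ∈ box s₀ η, z.2 < 0 → tube c (rotate (deriv c s₀)) z ∉ closure Ω) := by
  set N := rotate (deriv c s₀) with hN
  have hct := continuous_tube hc.continuous N
  obtain ⟨η₁, hη₁, hinj, hpos⟩ := exists_injOn_tube hc (N := N) (cross_rotate_self_pos hreg)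
  have hev : ∀ᶠ z in 𝓝 (s₀, (0 : ℝ)),
      tube c N z ∈ frontier Ω → tube c N z ∈ c '' Ioo (s₀ - η₁) (s₀ + η₁) := by
    have := hct.tendsto (s₀, 0)
    simp only [tube, zero_smul, sub_zero] at this
    exact this.eventually (hfr η₁ hη₁)
  obtain ⟨η₂, hη₂, hfr₂⟩ := exists_box_of_eventually hev
  set η := min ε (min η₁ η₂) with hηdef
  have hη : 0 < η := by simp [hηdef, hε, hη₁, hη₂]
  have hle₁ : η ≤ η₁ := (min_le_right _ _).trans (min_le_left _ _)
  have hle₂ : η ≤ η₂ := (min_le_right _ _).trans (min_le_right _ _)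
  have hfront : ∀ z ∈ box s₀ η, z.2 ≠ 0 → tube c N z ∉ frontier Ω := by
    intro z hz hz0 hmem
    obtain ⟨s, hs, hsz⟩ := hfr₂ z (box_mono s₀ hle₂ hz) hmem
    have : (s, (0 : ℝ)) = z := hinj (by rw [mem_box]; exact ⟨hs, by simpa using hη₁⟩)
      (box_mono s₀ hle₁ hz) (by rw [← hsz]; simp [tube])
    exact hz0 (by rw [← this])
  obtain ⟨z, hz, hz0⟩ := ((hout.and (Ioo_mem_nhdsGT hη)).and self_mem_nhdsWithin).exists
  have hz0 : 0 < z := hz0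
  refine ⟨η, hη, min_le_left _ _, hinj.mono (box_mono s₀ hle₁),
    fun z hz => hpos z (box_mono s₀ hle₁ hz), ?_, ?_⟩
  · have hconn : IsPreconnected (tube c N '' (Ioo (s₀ - η) (s₀ + η) ×ˢ Ioo 0 η)) :=
      (isPreconnected_Ioo.prod isPreconnected_Ioo).image _ hct.continuousOn
    have hsub := subset_or_of_disjoint_frontier hΩ hconn (by
      rintro _ ⟨w, hw, rfl⟩
      exact hfront w ⟨hw.1, by linarith [hw.2.1], hw.2.2⟩ hw.2.1.ne')
    have hmem : tube c N (s₀, z) ∈ tube c N '' (Ioo (s₀ - η) (s₀ + η) ×ˢ Ioo 0 η) :=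
      mem_image_of_mem _ ⟨by simp [hη], hz.2⟩
    rcases hsub with hsub | hsub
    · exact fun w hw hw0 => hsub (mem_image_of_mem _ ⟨hw.1, hw0, hw.2.2⟩)
    · exact absurd (subset_closure hz.1.1) (hsub hmem)
  · have hconn : IsPreconnected (tube c N '' (Ioo (s₀ - η) (s₀ + η) ×ˢ Ioo (-η) 0)) :=
      (isPreconnected_Ioo.prod isPreconnected_Ioo).image _ hct.continuousOn
    have hsub := subset_or_of_disjoint_frontier hΩ hconn (by
      rintro _ ⟨w, hw, rfl⟩
      exact hfront w ⟨hw.1, hw.2.1, by linarith [hw.2.2]⟩ hw.2.2.ne)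
    have hmem : tube c N (s₀, -z) ∈ tube c N '' (Ioo (s₀ - η) (s₀ + η) ×ˢ Ioo (-η) 0) :=
      mem_image_of_mem _ ⟨by simp [hη], by linarith [hz.2.2], by linarith⟩
    rcases hsub with hsub | hsub
    · refine absurd (subset_closure (hsub hmem)) ?_
      simpa [tube] using hz.1.2
    · exact fun w hw hw0 => hsub (mem_image_of_mem _ ⟨hw.1, hw.2.1, hw0⟩)

/-! ### Piecewise `C¹` boundaries and the local divergence theorem -/

/-- The frontier of `Ω` consists of finitely many `C¹` arcs `c i`, `0 ≤ s ≤ ℓ i`, regular and simple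
away from their endpoints, whose relative interiors are disjoint from each other and from all
endpoints, and along which the rotated tangent `r · c'` points out of `Ω`. Nothing is required at
the endpoints, where cusps are allowed; a closed curve is an arc with coinciding endpoints. -/
structure IsPiecewiseBoundary {ι : Type*} (Ω : Set Plane) (c : ι → ℝ → Plane) (ℓ : ι → ℝ) :
    Prop where
  pos : ∀ i, 0 < ℓ i
  contDiff : ∀ i, ContDiff ℝ 1 (c i)
  regular : ∀ i, ∀ s ∈ Ioo 0 (ℓ i), deriv (c i) s ≠ 0
  frontier_eq : frontier Ω = ⋃ i, c i '' Icc 0 (ℓ i)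
  simple : ∀ i j, ∀ s ∈ Ioo 0 (ℓ i), ∀ t ∈ Icc 0 (ℓ j), c i s = c j t → i = j ∧ s = t
  outward : ∀ i, ∀ s ∈ Ioo 0 (ℓ i), IsOutward Ω (c i s) (rotate (deriv (c i) s))

/-- The flux `∫ n · G ds` of `G` through the arcs `c i`; here `n ds = r · c' ds`. -/
def flux {ι : Type*} [Fintype ι] (c : ι → ℝ → Plane) (ℓ : ι → ℝ) (G : Plane → Plane) : ℝ :=
  ∑ i, ∫ s in (0 : ℝ)..ℓ i, cross (deriv (c i) s) (G (c i s))

/-- Fields that are continuous up to the boundary and `C¹` with integrable divergence inside. -/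
structure IsFluxField (Ω : Set Plane) (G : Plane → Plane) : Prop where
  continuousOn : ContinuousOn G (closure Ω)
  contDiffOn : ContDiffOn ℝ 1 G Ω
  integrableOn : IntegrableOn (div G) Ω

lemma div_eq_zero_of_notMem_tsupport {G : Plane → Plane} {x : Plane} (h : x ∉ tsupport G) :
    div G x = 0 := by
  have : G =ᶠ[𝓝 x] 0 := notMem_tsupport_iff_eventuallyEq.1 h
  rw [div_eq, this.fderiv_eq]
  simp

lemma eq_zero_of_tsupport_subset {G : Plane → Plane} {U : Set Plane} (h : tsupport G ⊆ U)
    {x : Plane} (hx : x ∉ U) : G x = 0 :=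
  image_eq_zero_of_notMem_tsupport fun h' => hx (h h')

lemma cross_zero_right (a : Plane) : cross a 0 = 0 := by simp [cross]

lemma flux_eq_zero {ι : Type*} [Fintype ι] {c : ι → ℝ → Plane} {ℓ : ι → ℝ} (hℓ : ∀ i, 0 < ℓ i)
    {G : Plane → Plane} (h : ∀ i, ∀ s ∈ Icc 0 (ℓ i), G (c i s) = 0) : flux c ℓ G = 0 := by
  refine Finset.sum_eq_zero fun i _ => ?_
  rw [intervalIntegral.integral_of_le (hℓ i).le]
  refine setIntegral_eq_zero_of_forall_eq_zero fun s hs => ?_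
  rw [h i s (Ioc_subset_Icc_self hs), cross_zero_right]

section Local

variable {ι : Type*} {Ω : Set Plane} {c : ι → ℝ → Plane} {ℓ : ι → ℝ}

lemma IsPiecewiseBoundary.mem_frontier (h : IsPiecewiseBoundary Ω c ℓ) (i : ι) {s : ℝ}
    (hs : s ∈ Icc 0 (ℓ i)) : c i s ∈ frontier Ω := by
  rw [h.frontier_eq]
  exact mem_iUnion.2 ⟨i, mem_image_of_mem _ hs⟩

lemma IsPiecewiseBoundary.mem_closure (h : IsPiecewiseBoundary Ω c ℓ) (i : ι) {s : ℝ}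
    (hs : s ∈ Icc 0 (ℓ i)) : c i s ∈ closure Ω :=
  frontier_subset_closure (h.mem_frontier i hs)

variable [Fintype ι]

lemma IsPiecewiseBoundary.eventually_frontier (h : IsPiecewiseBoundary Ω c ℓ) (i : ι) {s₀ : ℝ}
    (hs₀ : s₀ ∈ Ioo 0 (ℓ i)) (η : ℝ) (hη : 0 < η) :
    ∀ᶠ x in 𝓝 (c i s₀), x ∈ frontier Ω → x ∈ c i '' Ioo (s₀ - η) (s₀ + η) := by
  classical
  -- the rest of the frontier is compact and does not contain `c i s₀`
  set K : Set Plane := ⋃ j, c j '' (Icc 0 (ℓ j) \ if j = i then Ioo (s₀ - η) (s₀ + η) else ∅)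
  have hK : IsCompact K := isCompact_iUnion fun j => by
    refine IsCompact.image ?_ (h.contDiff j).continuous
    split_ifs
    · exact isCompact_Icc.diff isOpen_Ioo
    · simpa using isCompact_Icc
  have hmem : c i s₀ ∉ K := by
    intro hx
    obtain ⟨j, t, ht, hjt⟩ := mem_iUnion.1 hx
    obtain ⟨rfl, rfl⟩ := h.simple i j s₀ hs₀ t ht.1 hjt.symm
    exact ht.2 (by simp [hη])
  filter_upwards [hK.isClosed.isOpen_compl.mem_nhds hmem] with x hx hxf
  rw [h.frontier_eq] at hxf
  obtain ⟨j, t, ht, rfl⟩ := mem_iUnion.1 hxf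
  by_contra hcon
  refine hx (mem_iUnion.2 ⟨j, t, ⟨ht, ?_⟩, rfl⟩)
  split_ifs with hj
  · subst hj; exact fun h' => hcon (mem_image_of_mem _ h')
  · simp

/-- The divergence theorem for fields supported near a regular boundary point. -/
lemma IsPiecewiseBoundary.local_boundary (h : IsPiecewiseBoundary Ω c ℓ) (hΩ : IsOpen Ω) (i : ι)
    {s₀ : ℝ} (hs₀ : s₀ ∈ Ioo 0 (ℓ i)) :
    ∃ U, IsOpen U ∧ c i s₀ ∈ U ∧ ∀ G, IsFluxField Ω G → tsupport G ⊆ U →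
      ∫ x in Ω, div G x = flux c ℓ G := by
  obtain ⟨η, hη, hηε, hinj, hpos, hin, hout⟩ := exists_tube_box hΩ (h.contDiff i)
    (h.regular i s₀ hs₀) (h.outward i s₀ hs₀) (h.eventually_frontier i hs₀)
    (ε := min s₀ (ℓ i - s₀)) (lt_min hs₀.1 (sub_pos.2 hs₀.2))
  set N := rotate (deriv (c i) s₀)
  have hη1 : η ≤ s₀ := hηε.trans (min_le_left _ _)
  have hη2 : η ≤ ℓ i - s₀ := hηε.trans (min_le_right _ _)
  set a := s₀ - η / 2 with ha
  set b := s₀ + η / 2 with hb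
  have hhalf : box s₀ (η / 2) ⊆ box s₀ η := box_mono s₀ (by linarith)
  refine ⟨tube (c i) N '' box s₀ (η / 2), isOpen_image_tube (h.contDiff i) (isOpen_box _ _)
    fun z hz => (hpos z (hhalf hz)).ne', ⟨(s₀, 0), center_mem_box s₀ (by linarith),
      by simp [tube]⟩, fun G hG hsupp => ?_⟩
  have hsub : Icc a b ×ˢ Ioc 0 (η / 2) ⊆ box s₀ η := by
    rintro z ⟨hz1, hz2⟩
    rw [mem_box]
    constructor <;> constructor <;> linarith [hz1.1, hz1.2, hz2.1, hz2.2]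
  have hvan : ∀ z ∈ box s₀ η, z ∉ box s₀ (η / 2) → G (tube (c i) N z) = 0 := by
    intro z hz hz'
    refine eq_zero_of_tsupport_subset hsupp ?_
    rintro ⟨w, hw, hwz⟩
    exact hz' (hinj (hhalf hw) hz hwz ▸ hw)
  have key := integral_div_image_tube hΩ hG.continuousOn hG.contDiffOn hG.integrableOn
    (h.contDiff i) (N := N) (a := a) (b := b) (d := η / 2) (by linarith) (by linarith)
    (fun s hs t ht => hin _ (hsub ⟨hs, ht⟩) ht.1) (hinj.mono hsub)
    (fun s hs => hpos (s, 0) (by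
      rw [mem_box]; constructor <;> constructor <;> linarith [hs.1, hs.2]))
    (fun t ht => hvan _ (hsub ⟨⟨le_rfl, by linarith⟩, ht⟩) (by simp [mem_box, ha]))
    (fun t ht => hvan _ (hsub ⟨⟨by linarith, le_rfl⟩, ht⟩) (by simp [mem_box, hb]))
    (fun s hs => hvan _ (hsub ⟨hs, by linarith, le_rfl⟩) (by simp [mem_box]))
  -- away from the box the field vanishes in `Ω`
  have hvol : ∫ x in Ω, div G x = ∫ x in tube (c i) N '' (Icc a b ×ˢ Ioc 0 (η / 2)), div G x := by
    refine setIntegral_eq_of_subset_of_forall_sdiff_eq_zero hΩ.measurableSet ?_ ?_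
    · rintro _ ⟨z, hz, rfl⟩
      exact hin z (hsub hz) hz.2.1
    · rintro x ⟨hx, hx'⟩
      refine div_eq_zero_of_notMem_tsupport fun hxs => ?_
      obtain ⟨z, hz, rfl⟩ := hsupp hxs
      rcases lt_trichotomy z.2 0 with h0 | h0 | h0
      · exact hout z (hhalf hz) h0 (subset_closure hx)
      · rw [mem_box] at hz
        have hf := h.mem_frontier i (s := z.1)
          ⟨by linarith [hz.1.1], by linarith [hz.1.2]⟩
        rw [hΩ.frontier_eq] at hf
        exact hf.2 (by simpa [tube, h0] using hx)
      · rw [mem_box] at hz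
        exact hx' ⟨z, ⟨⟨hz.1.1.le, hz.1.2.le⟩, h0, hz.2.2.le⟩, rfl⟩
  -- on the boundary it vanishes off the arc `c i`, `a ≤ s ≤ b`
  have hoff : ∀ j, ∀ t ∈ Icc 0 (ℓ j), ¬(j = i ∧ t ∈ Ioc a b) → G (c j t) = 0 := by
    intro j t ht hjt
    refine eq_zero_of_tsupport_subset hsupp ?_
    rintro ⟨z, hz, hzt⟩
    have hf := h.mem_frontier j ht
    rcases lt_trichotomy z.2 0 with h0 | h0 | h0
    · exact hout z (hhalf hz) h0 (hzt ▸ frontier_subset_closure hf)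
    · rw [mem_box] at hz
      obtain ⟨hij, hst⟩ := h.simple i j z.1 ⟨by linarith [hz.1.1], by linarith [hz.1.2]⟩ t ht
        (by rw [← hzt]; simp [tube, h0])
      exact hjt ⟨hij.symm, by rw [← hst]; exact ⟨hz.1.1, hz.1.2.le⟩⟩
    · rw [hΩ.frontier_eq] at hf
      exact hf.2 (hzt ▸ hin z (hhalf hz) h0)
  rw [hvol, key, flux, Finset.sum_eq_single i]
  · rw [intervalIntegral.integral_of_le (by linarith), intervalIntegral.integral_of_le (h.pos i).le]
    refine (setIntegral_eq_of_subset_of_forall_sdiff_eq_zero measurableSet_Ioc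
      (Ioc_subset_Ioc (by linarith) (by linarith)) ?_).symm
    rintro t ⟨ht, ht'⟩
    rw [hoff i t (Ioc_subset_Icc_self ht) (fun h' => ht' h'.2), cross_zero_right]
  · intro j _ hj
    rw [intervalIntegral.integral_of_le (h.pos j).le]
    refine setIntegral_eq_zero_of_forall_eq_zero fun t ht => ?_
    rw [hoff j t (Ioc_subset_Icc_self ht) (fun h' => hj h'.1), cross_zero_right]
  · simp

/-- The divergence theorem for fields supported near an interior point. -/
lemma IsPiecewiseBoundary.local_interior (h : IsPiecewiseBoundary Ω c ℓ) (hΩ : IsOpen Ω)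
    {x₀ : Plane} (hx₀ : x₀ ∈ Ω) :
    ∃ U, IsOpen U ∧ x₀ ∈ U ∧ ∀ G, IsFluxField Ω G → tsupport G ⊆ U →
      ∫ x in Ω, div G x = flux c ℓ G := by
  obtain ⟨r, hr, hball⟩ := Metric.isOpen_iff.1 hΩ x₀ hx₀
  set ρ := r / 4 with hρ
  have hρ0 : 0 < ρ := by positivity
  set N : Plane := EuclideanSpace.single 1 1 with hN
  set k : ℝ → Plane := fun s => x₀ + s • EuclideanSpace.single 0 1 + ρ • N with hk
  have hkc : ContDiff ℝ 1 k := by simp only [hk]; fun_prop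
  have hkd : ∀ s, deriv k s = EuclideanSpace.single 0 1 := fun s => by
    have : HasDerivAt k ((1 : ℝ) • EuclideanSpace.single (0 : Fin 2) (1 : ℝ)) s :=
      (((hasDerivAt_id s).smul_const _).const_add x₀).add_const _
    simpa using this.deriv
  have hcr : ∀ s, cross (deriv k s) N = 1 := fun s => by simp [hkd, hN, cross]
  have hinj : Function.Injective (tube k N) := by
    rintro ⟨s, t⟩ ⟨s', t'⟩ hst
    have h0 := congrArg (fun x : Plane => x 0) hst
    have h1 := congrArg (fun x : Plane => x 1) hst
    simp [tube, hk, hN] at h0 h1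
    simp [h0, h1]
  have hmem : ∀ s ∈ Icc (-ρ) ρ, ∀ t ∈ Icc 0 (2 * ρ), tube k N (s, t) ∈ Ω := by
    intro s hs t ht
    refine hball ?_
    have : tube k N (s, t) - x₀ = s • EuclideanSpace.single 0 1 + (ρ - t) • N := by
      simp only [tube, hk]; module
    rw [mem_ball_iff_norm, this]
    calc _ ≤ ‖s • (EuclideanSpace.single 0 1 : Plane)‖ + ‖(ρ - t) • N‖ := norm_add_le _ _
      _ = |s| + |ρ - t| := by simp [norm_smul, hN]
      _ ≤ ρ + ρ := add_le_add (abs_le.2 hs) (abs_le.2 ⟨by linarith [ht.2], by linarith [ht.1]⟩)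
      _ < r := by linarith
  set S : Set (ℝ × ℝ) := Ioo (-ρ) ρ ×ˢ Ioo 0 (2 * ρ) with hS
  refine ⟨tube k N '' S, isOpen_image_tube hkc (isOpen_Ioo.prod isOpen_Ioo)
    fun z _ => by simp [hcr], ⟨(0, ρ), ⟨by simp [hρ0], hρ0, by linarith⟩, by simp [tube, hk]⟩,
    fun G hG hsupp => ?_⟩
  have hvan : ∀ z, z ∉ S → G (tube k N z) = 0 := by
    intro z hz
    refine eq_zero_of_tsupport_subset hsupp ?_
    rintro ⟨w, hw, hwz⟩
    exact hz (hinj hwz ▸ hw)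
  have key := integral_div_image_tube hΩ hG.continuousOn hG.contDiffOn hG.integrableOn
    hkc (N := N) (a := -ρ) (b := ρ) (d := 2 * ρ) (by linarith) (by linarith)
    (fun s hs t ht => hmem s hs t (Ioc_subset_Icc_self ht)) hinj.injOn
    (fun s _ => by simp [hcr]) (fun t _ => hvan _ (by simp [hS])) (fun t _ => hvan _ (by simp [hS]))
    (fun s _ => hvan _ (by simp [hS]))
  have hbot : ∀ s, G (k s) = 0 := fun s => by
    simpa [tube] using hvan (s, 0) (by simp [hS])
  simp only [hbot, cross_zero_right, intervalIntegral.integral_zero] at key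
  have himg : tube k N '' (Icc (-ρ) ρ ×ˢ Ioc 0 (2 * ρ)) ⊆ Ω := by
    rintro _ ⟨z, hz, rfl⟩
    exact hmem z.1 hz.1 z.2 (Ioc_subset_Icc_self hz.2)
  have hUS : tube k N '' S ⊆ tube k N '' (Icc (-ρ) ρ ×ˢ Ioc 0 (2 * ρ)) :=
    image_mono (prod_mono Ioo_subset_Icc_self Ioo_subset_Ioc_self)
  rw [setIntegral_eq_of_subset_of_forall_sdiff_eq_zero hΩ.measurableSet himg, key, flux_eq_zero h.pos]
  · intro i s hs
    refine eq_zero_of_tsupport_subset hsupp fun hU => ?_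
    have hf := h.mem_frontier i hs
    rw [hΩ.frontier_eq] at hf
    exact hf.2 (himg (hUS hU))
  · rintro x ⟨_, hx⟩
    exact div_eq_zero_of_notMem_tsupport fun hxs => hx (hUS (hsupp hxs))

end Local

/-! ### Localization by a partition of unity -/

lemma div_add {F G : Plane → Plane} {x : Plane} (hF : DifferentiableAt ℝ F x)
    (hG : DifferentiableAt ℝ G x) : div (F + G) x = div F x + div G x := by
  rw [div_eq, div_eq, div_eq, fderiv_add hF hG]
  simp; ring

lemma div_zero_field : div 0 = 0 := by
  funext x; rw [div_eq]; simp

lemma div_congr {F G : Plane → Plane} {Ω : Set Plane} (hΩ : IsOpen Ω) (h : EqOn F G Ω) :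
    EqOn (div F) (div G) Ω := fun x hx => by
  rw [div_eq, div_eq, (h.eventuallyEq_of_mem (hΩ.mem_nhds hx)).fderiv_eq]

lemma div_smul {φ : Plane → ℝ} {G : Plane → Plane} {x : Plane} (hφ : DifferentiableAt ℝ φ x)
    (hG : DifferentiableAt ℝ G x) : div (φ • G) x = φ x * div G x + fderiv ℝ φ x (G x) := by
  have h1 : fderiv ℝ φ x (G x) = G x 0 * fderiv ℝ φ x (EuclideanSpace.single 0 1)
      + G x 1 * fderiv ℝ φ x (EuclideanSpace.single 1 1) := by
    conv_lhs => rw [basis_expand (G x)]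
    simp
  rw [div_eq, div_eq, fderiv_smul hφ hG, h1]
  simp; ring

namespace IsFluxField

variable {Ω : Set Plane} {F G : Plane → Plane}

lemma differentiableAt (hG : IsFluxField Ω G) (hΩ : IsOpen Ω) {x : Plane} (hx : x ∈ Ω) :
    DifferentiableAt ℝ G x :=
  (hG.contDiffOn.differentiableOn one_ne_zero).differentiableAt (hΩ.mem_nhds hx)

lemma add (hF : IsFluxField Ω F) (hG : IsFluxField Ω G) (hΩ : IsOpen Ω) :
    IsFluxField Ω (F + G) where
  continuousOn := hF.continuousOn.add hG.continuousOn
  contDiffOn := hF.contDiffOn.add hG.contDiffOn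
  integrableOn := (hF.integrableOn.add hG.integrableOn).congr_fun
    (fun _ hx => (div_add (hF.differentiableAt hΩ hx) (hG.differentiableAt hΩ hx)).symm)
    hΩ.measurableSet

lemma zero : IsFluxField Ω 0 where
  continuousOn := continuousOn_const
  contDiffOn := contDiffOn_const
  integrableOn := by rw [div_zero_field]; exact integrableOn_zero

lemma sum {κ : Type*} (hΩ : IsOpen Ω) (S : Finset κ) {H : κ → Plane → Plane}
    (hH : ∀ k ∈ S, IsFluxField Ω (H k)) : IsFluxField Ω (∑ k ∈ S, H k) := by
  classical
  induction S using Finset.induction_on with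
  | empty => simpa using zero
  | insert k S hk ih =>
    rw [Finset.sum_insert hk]
    exact (hH k (by simp)).add (ih fun j hj => hH j (by simp [hj])) hΩ

lemma integrableOn_smul_div (hG : IsFluxField Ω G) (hΩ : IsOpen Ω) (hb : Bornology.IsBounded Ω)
    {φ : Plane → ℝ} (hφ : Continuous φ) : IntegrableOn (fun x => φ x * div G x) Ω :=
  hG.integrableOn.continuousOn_mul_of_subset (K := closure Ω) hφ.continuousOn
    hb.isCompact_closure hΩ.measurableSet subset_closure

lemma integrableOn_fderiv (hG : IsFluxField Ω G) (hb : Bornology.IsBounded Ω)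
    {φ : Plane → ℝ} (hφ : ContDiff ℝ 1 φ) : IntegrableOn (fun x => fderiv ℝ φ x (G x)) Ω :=
  (((hφ.continuous_fderiv one_ne_zero).continuousOn.clm_apply hG.continuousOn).integrableOn_compact
    hb.isCompact_closure).mono_set subset_closure

lemma smul (hG : IsFluxField Ω G) (hΩ : IsOpen Ω) (hb : Bornology.IsBounded Ω)
    {φ : Plane → ℝ} (hφ : ContDiff ℝ 1 φ) : IsFluxField Ω (φ • G) where
  continuousOn := hφ.continuous.continuousOn.smul hG.continuousOn
  contDiffOn := hφ.contDiffOn.smul hG.contDiffOn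
  integrableOn := ((hG.integrableOn_smul_div hΩ hb hφ.continuous).add
    (hG.integrableOn_fderiv hb hφ)).congr_fun (fun x hx => (div_smul
      (hφ.differentiable one_ne_zero x) (hG.differentiableAt hΩ hx)).symm) hΩ.measurableSet

end IsFluxField

section Defect

variable {ι : Type*} {Ω : Set Plane} {c : ι → ℝ → Plane} {ℓ : ι → ℝ}

lemma IsPiecewiseBoundary.continuousOn_integrand (h : IsPiecewiseBoundary Ω c ℓ)
    {G : Plane → Plane} (hG : ContinuousOn G (closure Ω)) (i : ι) :
    ContinuousOn (fun s => cross (deriv (c i) s) (G (c i s))) (Icc 0 (ℓ i)) :=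
  continuous_cross.comp_continuousOn
    ((((h.contDiff i).continuous_deriv le_rfl).continuousOn).prodMk
      (hG.comp (h.contDiff i).continuous.continuousOn fun _ hs => h.mem_closure i hs))

lemma IsPiecewiseBoundary.intervalIntegrable (h : IsPiecewiseBoundary Ω c ℓ)
    {G : Plane → Plane} (hG : ContinuousOn G (closure Ω)) (i : ι) :
    IntervalIntegrable (fun s => cross (deriv (c i) s) (G (c i s))) volume 0 (ℓ i) :=
  ContinuousOn.intervalIntegrable
    (by rw [uIcc_of_le (h.pos i).le]; exact h.continuousOn_integrand hG i)

variable [Fintype ι]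

/-- The defect in the divergence theorem: the integral of the divergence minus the boundary flux. -/
def defect (Ω : Set Plane) (c : ι → ℝ → Plane) (ℓ : ι → ℝ) (G : Plane → Plane) : ℝ :=
  (∫ x in Ω, div G x) - flux c ℓ G

lemma IsPiecewiseBoundary.defect_add (h : IsPiecewiseBoundary Ω c ℓ) (hΩ : IsOpen Ω)
    {F G : Plane → Plane} (hF : IsFluxField Ω F) (hG : IsFluxField Ω G) :
    defect Ω c ℓ (F + G) = defect Ω c ℓ F + defect Ω c ℓ G := by
  have h1 : ∫ x in Ω, div (F + G) x = (∫ x in Ω, div F x) + ∫ x in Ω, div G x := by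
    rw [← integral_add hF.integrableOn hG.integrableOn]
    exact setIntegral_congr_fun hΩ.measurableSet fun x hx =>
      div_add (hF.differentiableAt hΩ hx) (hG.differentiableAt hΩ hx)
  have h2 : flux c ℓ (F + G) = flux c ℓ F + flux c ℓ G := by
    simp only [flux, ← Finset.sum_add_distrib]
    refine Finset.sum_congr rfl fun i _ => ?_
    rw [← intervalIntegral.integral_add (h.intervalIntegrable hF.continuousOn i)
      (h.intervalIntegrable hG.continuousOn i)]
    simp [cross_add_right]
  simp only [defect, h1, h2]; ring

lemma IsPiecewiseBoundary.defect_congr (h : IsPiecewiseBoundary Ω c ℓ) (hΩ : IsOpen Ω)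
    {F G : Plane → Plane} (hFG : EqOn F G (closure Ω)) : defect Ω c ℓ F = defect Ω c ℓ G := by
  have h1 : ∫ x in Ω, div F x = ∫ x in Ω, div G x :=
    setIntegral_congr_fun hΩ.measurableSet (div_congr hΩ (hFG.mono subset_closure))
  have h2 : flux c ℓ F = flux c ℓ G := by
    refine Finset.sum_congr rfl fun i _ => intervalIntegral.integral_congr fun s hs => ?_
    rw [uIcc_of_le (h.pos i).le] at hs
    simp only [hFG (h.mem_closure i hs)]
  rw [defect, defect, h1, h2]

lemma IsPiecewiseBoundary.defect_sum (h : IsPiecewiseBoundary Ω c ℓ) (hΩ : IsOpen Ω)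
    {κ : Type*} (S : Finset κ) {H : κ → Plane → Plane} (hH : ∀ k ∈ S, IsFluxField Ω (H k))
    (h0 : ∀ k ∈ S, defect Ω c ℓ (H k) = 0) : defect Ω c ℓ (∑ k ∈ S, H k) = 0 := by
  classical
  induction S using Finset.induction_on with
  | empty =>
    simp [defect, div_zero_field, flux, cross]
  | insert k S hk ih =>
    rw [Finset.sum_insert hk, h.defect_add hΩ (hH k (by simp))
      (IsFluxField.sum hΩ S fun j hj => hH j (by simp [hj])), h0 k (by simp),
      ih (fun j hj => hH j (by simp [hj])) (fun j hj => h0 j (by simp [hj])), add_zero]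

/-- The divergence theorem holds for fields supported in some neighbourhood of `x`. -/
def IsGood (Ω : Set Plane) (c : ι → ℝ → Plane) (ℓ : ι → ℝ) (x : Plane) : Prop :=
  ∃ U, IsOpen U ∧ x ∈ U ∧ ∀ G, IsFluxField Ω G → tsupport G ⊆ U → defect Ω c ℓ G = 0

lemma IsPiecewiseBoundary.isGood (h : IsPiecewiseBoundary Ω c ℓ) (hΩ : IsOpen Ω) {x : Plane}
    (hx : x ∈ closure Ω) (hK : ∀ i, x ≠ c i 0 ∧ x ≠ c i (ℓ i)) : IsGood Ω c ℓ x := by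
  by_cases hxΩ : x ∈ Ω
  · obtain ⟨U, hU, hxU, H⟩ := h.local_interior hΩ hxΩ
    exact ⟨U, hU, hxU, fun G hG hs => sub_eq_zero.2 (H G hG hs)⟩
  · have hf : x ∈ frontier Ω := hΩ.frontier_eq ▸ ⟨hx, hxΩ⟩
    rw [h.frontier_eq] at hf
    obtain ⟨i, s, hs, rfl⟩ := mem_iUnion.1 hf
    have hs0 : s ≠ 0 := fun h0 => (hK i).1 (by rw [h0])
    have hsℓ : s ≠ ℓ i := fun h0 => (hK i).2 (by rw [h0])
    obtain ⟨U, hU, hxU, H⟩ := h.local_boundary hΩ i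
      ⟨lt_of_le_of_ne hs.1 hs0.symm, lt_of_le_of_ne hs.2 hsℓ⟩
    exact ⟨U, hU, hxU, fun G hG hs => sub_eq_zero.2 (H G hG hs)⟩

open scoped Manifold ContDiff in
/-- If every point of the closure in the support of `G` is good, a partition of unity subordinate
to finitely many of the neighbourhoods splits `G` into fields without defect. -/
lemma IsPiecewiseBoundary.defect_eq_zero_of_isGood (h : IsPiecewiseBoundary Ω c ℓ) (hΩ : IsOpen Ω)
    (hb : Bornology.IsBounded Ω) {G : Plane → Plane} (hG : IsFluxField Ω G)
    (hgood : ∀ x ∈ closure Ω, x ∈ tsupport G → IsGood Ω c ℓ x) : defect Ω c ℓ G = 0 := by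
  set S := closure Ω ∩ tsupport G
  have hS : IsCompact S := hb.isCompact_closure.inter_right (isClosed_tsupport G)
  choose! U hUo hxU hU using fun (x : Plane) (hx : x ∈ S) => hgood x hx.1 hx.2
  obtain ⟨t, ht, htS⟩ := hS.elim_nhds_subcover U fun x hx => (hUo x hx).mem_nhds (hxU x hx)
  obtain ⟨f, hf⟩ := SmoothPartitionOfUnity.exists_isSubordinate 𝓘(ℝ, Plane) hS.isClosed
    (fun x : t => U x) (fun x => hUo x (ht x x.2)) (by
      intro y hy
      obtain ⟨x, hx, hyx⟩ := mem_iUnion₂.1 (htS hy)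
      exact mem_iUnion.2 ⟨⟨x, hx⟩, hyx⟩)
  have hfs : ∀ k, ContDiff ℝ 1 (f k) := fun k =>
    ((f k).contMDiff.contDiff).of_le (by exact_mod_cast le_top)
  have heq : EqOn G (∑ k, (f k : Plane → ℝ) • G) (closure Ω) := by
    intro x hx
    by_cases hxG : x ∈ tsupport G
    · have h1 := f.sum_eq_one (x := x) ⟨hx, hxG⟩
      rw [finsum_eq_sum_of_fintype] at h1
      rw [Finset.sum_apply]
      simp only [Pi.smul_apply']
      rw [← Finset.sum_smul, h1, one_smul]
    · simp [image_eq_zero_of_notMem_tsupport hxG]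
  rw [h.defect_congr hΩ heq]
  refine h.defect_sum hΩ _ (fun k _ => hG.smul hΩ hb (hfs k)) fun k _ => ?_
  exact hU k (ht k k.2) _ (hG.smul hΩ hb (hfs k))
    ((tsupport_smul_subset_left _ _).trans (hf k))

end Defect

/-! ### Cutting off the exceptional boundary points -/

/-- A smooth cutoff, equal to `1` within distance `1 / (n + 1)` of `k` and to `0` beyond twice
that distance. -/
def cutoff (k : Plane) (n : ℕ) (x : Plane) : ℝ :=
  (⟨1, 2, one_pos, one_lt_two⟩ : ContDiffBump (0 : Plane)) (((n : ℝ) + 1) • (x - k))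

lemma contDiff_cutoff (k : Plane) (n : ℕ) : ContDiff ℝ 1 (cutoff k n) :=
  (ContDiffBump.contDiff _).comp (by fun_prop)

lemma cutoff_nonneg (k : Plane) (n : ℕ) (x : Plane) : 0 ≤ cutoff k n x := ContDiffBump.nonneg _

lemma cutoff_le_one (k : Plane) (n : ℕ) (x : Plane) : cutoff k n x ≤ 1 := ContDiffBump.le_one _

lemma cutoff_eq_one {k x : Plane} {n : ℕ} (h : ((n : ℝ) + 1) * dist x k ≤ 1) :
    cutoff k n x = 1 := by
  refine ContDiffBump.one_of_mem_closedBall _ ?_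
  rw [mem_closedBall_zero_iff, norm_smul, ← dist_eq_norm, Real.norm_of_nonneg (by positivity)]
  exact h

lemma cutoff_eq_zero {k x : Plane} {n : ℕ} (h : 2 ≤ ((n : ℝ) + 1) * dist x k) :
    cutoff k n x = 0 := by
  refine ContDiffBump.zero_of_le_dist _ ?_
  rw [dist_zero_right, norm_smul, ← dist_eq_norm, Real.norm_of_nonneg (by positivity)]
  exact h

lemma tendsto_cutoff {k x : Plane} (h : x ≠ k) : Tendsto (fun n => cutoff k n x) atTop (𝓝 0) := by
  refine tendsto_const_nhds.congr' ?_
  obtain ⟨m, hm⟩ := exists_nat_ge (2 / dist x k)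
  filter_upwards [eventually_ge_atTop m] with n hn
  refine (cutoff_eq_zero ?_).symm
  have hd := dist_pos.2 h
  rw [div_le_iff₀ hd] at hm
  have : (m : ℝ) ≤ n := by exact_mod_cast hn
  nlinarith

lemma exists_bound_fderiv_cutoff :
    ∃ M, 0 ≤ M ∧ ∀ (k : Plane) (n : ℕ) (x : Plane),
      ‖fderiv ℝ (cutoff k n) x‖ ≤ ((n : ℝ) + 1) * M := by
  set b : ContDiffBump (0 : Plane) := ⟨1, 2, one_pos, one_lt_two⟩ with hb
  have hbc : ContDiff ℝ 1 b := b.contDiff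
  obtain ⟨M, hM⟩ := (b.hasCompactSupport.fderiv ℝ).exists_bound_of_continuous
    (hbc.continuous_fderiv one_ne_zero)
  refine ⟨M, (norm_nonneg _).trans (hM 0), fun k n x => ?_⟩
  have h1 : HasFDerivAt (fun x : Plane => ((n : ℝ) + 1) • (x - k))
      (((n : ℝ) + 1) • ContinuousLinearMap.id ℝ Plane) x :=
    ((hasFDerivAt_id x).sub_const k).const_smul ((n : ℝ) + 1)
  have h2 := ((hbc.differentiable one_ne_zero (((n : ℝ) + 1) • (x - k))).hasFDerivAt.comp x h1)
  have h3 : fderiv ℝ (cutoff k n) x = _ := h2.fderiv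
  rw [h3, ContinuousLinearMap.comp_smul, norm_smul, Real.norm_of_nonneg (by positivity)]
  gcongr
  simpa using hM (((n : ℝ) + 1) • (x - k))

lemma fderiv_cutoff_eq_zero {k x : Plane} {n : ℕ} (h : 2 < ((n : ℝ) + 1) * dist x k) :
    fderiv ℝ (cutoff k n) x = 0 := by
  have : cutoff k n =ᶠ[𝓝 x] fun _ => 0 := by
    have hc : Continuous fun y : Plane => ((n : ℝ) + 1) * dist y k := by fun_prop
    filter_upwards [hc.continuousAt.eventually (lt_mem_nhds h)] with y hy
    exact cutoff_eq_zero hy.le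
  rw [this.fderiv_eq]; simp

section Corner

variable {ι : Type*} [Fintype ι] {Ω : Set Plane} {c : ι → ℝ → Plane} {ℓ : ι → ℝ}

/-- The gradient of the cutoff is of order `n` on a set of area of order `n⁻²`. -/
lemma tendsto_integral_fderiv_cutoff (hΩ : IsOpen Ω) {G : Plane → Plane}
    (hb : Bornology.IsBounded Ω) (hG : ContinuousOn G (closure Ω)) (k : Plane) :
    Tendsto (fun n => ∫ x in Ω, fderiv ℝ (cutoff k n) x (G x)) atTop (𝓝 0) := by
  obtain ⟨M, hM0, hM⟩ := exists_bound_fderiv_cutoff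
  obtain ⟨B, hB⟩ := hb.isCompact_closure.exists_bound_of_continuousOn hG
  have hB0 : 0 ≤ max B 0 := le_max_right _ _
  set V := (volume (Metric.ball (0 : Plane) 1)).toReal with hV
  have hbound : ∀ n : ℕ, ‖∫ x in Ω, fderiv ℝ (cutoff k n) x (G x)‖
      ≤ (9 * M * max B 0 * V) * (1 / ((n : ℝ) + 1)) := by
    intro n
    set r : ℝ := 3 / ((n : ℝ) + 1) with hr
    have hr0 : 0 < r := by positivity
    have hsub : ∫ x in Ω, fderiv ℝ (cutoff k n) x (G x)
        = ∫ x in Ω ∩ Metric.ball k r, fderiv ℝ (cutoff k n) x (G x) := by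
      refine setIntegral_eq_of_subset_of_forall_sdiff_eq_zero hΩ.measurableSet inter_subset_left ?_
      rintro x ⟨hx, hx'⟩
      have hd : r ≤ dist x k := by
        by_contra! h'; exact hx' ⟨hx, h'⟩
      rw [fderiv_cutoff_eq_zero]
      · simp
      · rw [hr, div_le_iff₀ (by positivity)] at hd
        linarith
    have hvol : volume.real (Ω ∩ Metric.ball k r) ≤ r ^ 2 * V := by
      have h1 : volume.real (Metric.ball k r) = r ^ 2 * V := by
        rw [Measure.real, Measure.addHaar_ball _ _ hr0.le, ENNReal.toReal_mul,
          ENNReal.toReal_ofReal (by positivity)]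
        simp [hV]
      rw [← h1]
      exact measureReal_mono inter_subset_right measure_ball_lt_top.ne
    rw [hsub]
    calc _ ≤ (((n : ℝ) + 1) * M * max B 0) * volume.real (Ω ∩ Metric.ball k r) := by
          refine norm_setIntegral_le_of_norm_le_const
            ((measure_mono inter_subset_right).trans_lt measure_ball_lt_top) fun x hx => ?_
          refine (ContinuousLinearMap.le_opNorm _ _).trans ?_
          gcongr
          · exact hM k n x
          · exact (hB x (subset_closure hx.1)).trans (le_max_left _ _)
      _ ≤ (((n : ℝ) + 1) * M * max B 0) * (r ^ 2 * V) := by gcongr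
      _ = _ := by rw [hr]; field_simp; ring
  refine squeeze_zero_norm hbound ?_
  simpa using (tendsto_one_div_add_atTop_nhds_zero_nat (𝕜 := ℝ)).const_mul (9 * M * max B 0 * V)

lemma tendsto_integral_cutoff_mul {G : Plane → Plane} (hG : IsFluxField Ω G)
    (k : Plane) : Tendsto (fun n => ∫ x in Ω, cutoff k n x * div G x) atTop (𝓝 0) := by
  have := tendsto_integral_of_dominated_convergence (μ := volume.restrict Ω)
    (F := fun n x => cutoff k n x * div G x) (f := fun _ => 0) (fun x => ‖div G x‖)
    (fun n => ((contDiff_cutoff k n).continuous.aestronglyMeasurable).mul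
      hG.integrableOn.aestronglyMeasurable) hG.integrableOn.norm
    (fun n => Eventually.of_forall fun x => ?_) ?_
  · simpa using this
  · rw [norm_mul, Real.norm_of_nonneg (cutoff_nonneg k n x)]
    exact mul_le_of_le_one_left (norm_nonneg _) (cutoff_le_one k n x)
  · have hk : ∀ᵐ x ∂(volume.restrict Ω), x ≠ k := by
      refine ae_restrict_of_ae ?_
      simp [ae_iff]
    filter_upwards [hk] with x hx
    simpa using (tendsto_cutoff hx).mul_const (div G x)

lemma IsPiecewiseBoundary.tendsto_flux_cutoff (h : IsPiecewiseBoundary Ω c ℓ) {G : Plane → Plane}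
    (hG : ContinuousOn G (closure Ω)) {k : Plane} (hk : ∀ i, ∀ s ∈ Ioo 0 (ℓ i), c i s ≠ k) :
    Tendsto (fun n => flux c ℓ (cutoff k n • G)) atTop (𝓝 0) := by
  have : ∀ i ∈ (Finset.univ : Finset ι), Tendsto (fun n => ∫ s in (0 : ℝ)..ℓ i,
      cross (deriv (c i) s) ((cutoff k n • G) (c i s))) atTop (𝓝 0) := by
    intro i _
    obtain ⟨B, hB⟩ := isCompact_Icc.exists_bound_of_continuousOn (h.continuousOn_integrand hG i)
    have := intervalIntegral.tendsto_integral_filter_of_dominated_convergence (a := 0) (b := ℓ i)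
      (μ := volume) (l := atTop)
      (F := fun n s => cross (deriv (c i) s) ((cutoff k n • G) (c i s)))
      (f := fun _ => (0 : ℝ)) (fun _ => B) ?_ ?_ intervalIntegrable_const ?_
    · simpa using this
    · refine Eventually.of_forall fun n => ?_
      rw [uIoc_of_le (h.pos i).le]
      refine ((h.continuousOn_integrand (G := cutoff k n • G) ?_ i).mono
        Ioc_subset_Icc_self).aestronglyMeasurable measurableSet_Ioc
      exact (contDiff_cutoff k n).continuous.continuousOn.smul hG
    · refine Eventually.of_forall fun n => Eventually.of_forall fun s hs => ?_
      rw [uIoc_of_le (h.pos i).le] at hs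
      simp only [Pi.smul_apply', cross_smul_right]
      rw [norm_mul, Real.norm_of_nonneg (cutoff_nonneg _ _ _)]
      exact (mul_le_of_le_one_left (norm_nonneg _) (cutoff_le_one _ _ _)).trans
        (hB s (Ioc_subset_Icc_self hs))
    · have hne : ∀ᵐ s ∂(volume : Measure ℝ), s ≠ ℓ i := by simp [ae_iff]
      filter_upwards [hne] with s hs hsI
      rw [uIoc_of_le (h.pos i).le] at hsI
      simp only [Pi.smul_apply', cross_smul_right]
      simpa using (tendsto_cutoff (hk i s ⟨hsI.1, lt_of_le_of_ne hsI.2 hs⟩)).mul_const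
        (cross (deriv (c i) s) (G (c i s)))
  simpa [flux] using tendsto_finsetSum _ this

/-- Finitely many exceptional points do not affect the divergence theorem: they are cut off one by
one. -/
lemma IsPiecewiseBoundary.defect_eq_zero_of_isGood_off_finset (h : IsPiecewiseBoundary Ω c ℓ)
    (hΩ : IsOpen Ω) (hb : Bornology.IsBounded Ω) (K : Finset Plane)
    (hK : ∀ k ∈ K, ∀ i, ∀ s ∈ Ioo 0 (ℓ i), c i s ≠ k) :
    ∀ G, IsFluxField Ω G → (∀ x ∈ closure Ω, x ∈ tsupport G → IsGood Ω c ℓ x ∨ x ∈ K) →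
      defect Ω c ℓ G = 0 := by
  classical
  induction K using Finset.induction_on with
  | empty =>
    intro G hG hgood
    exact h.defect_eq_zero_of_isGood hΩ hb hG fun x hx hx' => by simpa using hgood x hx hx'
  | insert k K _ ih =>
    intro G hG hgood
    have hcut : ∀ n, IsFluxField Ω (cutoff k n • G) := fun n => hG.smul hΩ hb (contDiff_cutoff k n)
    have hcut' : ∀ n, IsFluxField Ω ((fun x => 1 - cutoff k n x) • G) := fun n =>
      hG.smul hΩ hb (contDiff_const.sub (contDiff_cutoff k n))
    have hfar : ∀ n, defect Ω c ℓ ((fun x => 1 - cutoff k n x) • G) = 0 := by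
      intro n
      refine ih (fun j hj => hK j (by simp [hj])) _ (hcut' n) fun x hx hxs => ?_
      rcases hgood x hx (tsupport_smul_subset_right (fun x => 1 - cutoff k n x) G hxs) with hg | hxK
      · exact Or.inl hg
      · rcases Finset.mem_insert.1 hxK with rfl | hxK
        · refine absurd hxs (notMem_tsupport_iff_eventuallyEq.2 ?_)
          filter_upwards [Metric.ball_mem_nhds x (ε := 1 / ((n : ℝ) + 1)) (by positivity)] with y hy
          have hy' : dist y x ≤ 1 / ((n : ℝ) + 1) := (Metric.mem_ball.1 hy).le
          rw [le_div_iff₀ (by positivity), mul_comm] at hy'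
          simp [cutoff_eq_one hy']
        · exact Or.inr hxK
    have hsplit : ∀ n, defect Ω c ℓ G = defect Ω c ℓ (cutoff k n • G) := by
      intro n
      have : G = cutoff k n • G + (fun x => 1 - cutoff k n x) • G := by
        funext x; simp [sub_smul]
      conv_lhs => rw [this]
      rw [h.defect_add hΩ (hcut n) (hcut' n), hfar, add_zero]
    have hlim : Tendsto (fun n => defect Ω c ℓ (cutoff k n • G)) atTop (𝓝 0) := by
      have hvol : ∀ n, ∫ x in Ω, div (cutoff k n • G) x
          = (∫ x in Ω, cutoff k n x * div G x) + ∫ x in Ω, fderiv ℝ (cutoff k n) x (G x) := by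
        intro n
        rw [← integral_add (hG.integrableOn_smul_div hΩ hb (contDiff_cutoff k n).continuous)
          (hG.integrableOn_fderiv hb (contDiff_cutoff k n))]
        exact setIntegral_congr_fun hΩ.measurableSet fun x hx => div_smul
          ((contDiff_cutoff k n).differentiable one_ne_zero x) (hG.differentiableAt hΩ hx)
      have := ((tendsto_integral_cutoff_mul hG k).add
        (tendsto_integral_fderiv_cutoff hΩ hb hG.continuousOn k)).sub
        (h.tendsto_flux_cutoff hG.continuousOn (hK k (by simp)))
      simp only [← hvol, add_zero, sub_zero] at this
      exact this
    simp only [← hsplit] at hlim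
    exact tendsto_nhds_unique tendsto_const_nhds hlim

/-- The divergence theorem for a bounded plane open set whose boundary consists of finitely many
`C¹` arcs, for fields that are differentiable only in the interior. -/
theorem IsPiecewiseBoundary.integral_div (h : IsPiecewiseBoundary Ω c ℓ) (hΩ : IsOpen Ω)
    (hb : Bornology.IsBounded Ω) {G : Plane → Plane} (hG : IsFluxField Ω G) :
    ∫ x in Ω, div G x = flux c ℓ G := by
  classical
  refine sub_eq_zero.1 (h.defect_eq_zero_of_isGood_off_finset hΩ hb
    (Finset.univ.image (fun i => c i 0) ∪ Finset.univ.image (fun i => c i (ℓ i))) ?_ G hG ?_)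
  · intro k hk i s hs hsk
    have hends : ∀ j, ∀ t ∈ Icc 0 (ℓ j), (t = 0 ∨ t = ℓ j) → c i s = c j t → False := by
      intro j t ht ht' hst
      obtain ⟨rfl, rfl⟩ := h.simple i j s hs t ht hst
      rcases ht' with h0 | h0
      · exact hs.1.ne' h0
      · exact hs.2.ne h0
    simp only [Finset.mem_union, Finset.mem_image, Finset.mem_univ, true_and] at hk
    rcases hk with ⟨j, rfl⟩ | ⟨j, rfl⟩
    · exact hends j 0 ⟨le_rfl, (h.pos j).le⟩ (Or.inl rfl) hsk
    · exact hends j (ℓ j) ⟨(h.pos j).le, le_rfl⟩ (Or.inr rfl) hsk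
  · intro x hx _
    by_cases hxK : ∀ i, x ≠ c i 0 ∧ x ≠ c i (ℓ i)
    · exact Or.inl (h.isGood hΩ hx hxK)
    · right
      push Not at hxK
      obtain ⟨i, hi⟩ := hxK
      simp only [Finset.mem_union, Finset.mem_image, Finset.mem_univ, true_and]
      by_cases h0 : x = c i 0
      · exact Or.inl ⟨i, h0.symm⟩
      · exact Or.inr ⟨i, (hi h0).symm⟩

end Corner

/-! ### Traces -/

section Traces

variable {Y Z : Type*} [TopologicalSpace Y] [TopologicalSpace Z] {Ω : Set Plane} {f : Plane → Y}

lemma HasTraces.tendsto (hf : HasTraces Ω f) {x : Plane} (hx : x ∈ closure Ω) :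
    Tendsto f (𝓝[Ω] x) (𝓝 (tr Ω f x)) :=
  tendsto_extendFrom (hf x hx)

lemma tr_eq_of_tendsto [T2Space Y] {x : Plane} (hx : x ∈ closure Ω) {y : Y}
    (hf : Tendsto f (𝓝[Ω] x) (𝓝 y)) : tr Ω f x = y :=
  extendFrom_eq hx hf

lemma HasTraces.continuousOn_tr [RegularSpace Y] (hf : HasTraces Ω f) :
    ContinuousOn (tr Ω f) (closure Ω) :=
  continuousOn_extendFrom Subset.rfl hf

lemma tr_eq_self [T2Space Y] (hf : ContinuousOn f Ω) {x : Plane} (hx : x ∈ Ω) : tr Ω f x = f x :=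
  tr_eq_of_tendsto (subset_closure hx) (hf x hx)

lemma HasTraces.comp (hf : HasTraces Ω f) {Φ : Y → Z} (hΦ : Continuous Φ) :
    HasTraces Ω (fun x => Φ (f x)) := fun _ hx =>
  ⟨_, (hΦ.tendsto _).comp (hf.tendsto hx)⟩

lemma HasTraces.tr_comp [T2Space Z] (hf : HasTraces Ω f) {Φ : Y → Z} (hΦ : Continuous Φ) {x : Plane}
    (hx : x ∈ closure Ω) : tr Ω (fun x => Φ (f x)) x = Φ (tr Ω f x) :=
  tr_eq_of_tendsto hx ((hΦ.tendsto _).comp (hf.tendsto hx))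

lemma HasTraces.prodMk {g : Plane → Z} (hf : HasTraces Ω f) (hg : HasTraces Ω g) :
    HasTraces Ω (fun x => (f x, g x)) := fun _ hx =>
  ⟨_, (hf.tendsto hx).prodMk_nhds (hg.tendsto hx)⟩

lemma HasTraces.tr_prodMk [T2Space Y] [T2Space Z] {g : Plane → Z} (hf : HasTraces Ω f)
    (hg : HasTraces Ω g) {x : Plane} (hx : x ∈ closure Ω) :
    tr Ω (fun x => (f x, g x)) x = (tr Ω f x, tr Ω g x) :=
  tr_eq_of_tendsto hx ((hf.tendsto hx).prodMk_nhds (hg.tendsto hx))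

end Traces

/-! ### The tensor `E` as a bilinear form in gradients and pressures -/

section PointE

/-- The value of the tensor `E((u,p),(v,q))` in terms of `A = ∇u`, `B = ∇v` and the pressures. -/
def pointE (A : Matrix (Fin 2) (Fin 2) ℝ) (p : ℝ) (B : Matrix (Fin 2) (Fin 2) ℝ) (q : ℝ) :
    Matrix (Fin 2) (Fin 2) ℝ :=
  (2 * ddot ((1 / 2 : ℝ) • (A + Aᵀ)) ((1 / 2 : ℝ) • (B + Bᵀ))) • (1 : Matrix (Fin 2) (Fin 2) ℝ)
    - (2 : ℝ) • (((1 / 2 : ℝ) • (A + Aᵀ)) * B) - (2 : ℝ) • (((1 / 2 : ℝ) • (B + Bᵀ)) * A)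
    + p • (B - B.trace • (1 : Matrix (Fin 2) (Fin 2) ℝ))
    + q • (A - A.trace • (1 : Matrix (Fin 2) (Fin 2) ℝ))

variable (A B : Matrix (Fin 2) (Fin 2) ℝ) (p q : ℝ)

lemma pointE_zero_zero : pointE A p B q 0 0 =
    2 * A 1 1 * B 1 1 + A 0 1 * B 0 1 - A 1 0 * B 1 0 - 2 * A 0 0 * B 0 0
      - p * B 1 1 - q * A 1 1 := by
  simp [pointE, ddot, Matrix.mul_apply, Matrix.trace, Fin.sum_univ_two]; ring

lemma pointE_zero_one : pointE A p B q 0 1 =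
    -2 * A 0 0 * B 0 1 - (A 0 1 + A 1 0) * B 1 1 - 2 * B 0 0 * A 0 1 - (B 0 1 + B 1 0) * A 1 1
      + p * B 0 1 + q * A 0 1 := by
  simp [pointE, ddot, Matrix.mul_apply, Matrix.trace, Fin.sum_univ_two]; ring

lemma pointE_one_zero : pointE A p B q 1 0 =
    -(A 0 1 + A 1 0) * B 0 0 - 2 * A 1 1 * B 1 0 - (B 0 1 + B 1 0) * A 0 0 - 2 * B 1 1 * A 1 0
      + p * B 1 0 + q * A 1 0 := by
  simp [pointE, ddot, Matrix.mul_apply, Matrix.trace, Fin.sum_univ_two]; ring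

lemma pointE_one_one : pointE A p B q 1 1 =
    2 * A 0 0 * B 0 0 + A 1 0 * B 1 0 - A 0 1 * B 0 1 - 2 * A 1 1 * B 1 1
      - p * B 0 0 - q * A 0 0 := by
  simp [pointE, ddot, Matrix.mul_apply, Matrix.trace, Fin.sum_univ_two]; ring

lemma continuous_pointE : Continuous fun z : (Matrix (Fin 2) (Fin 2) ℝ × ℝ) ×
    (Matrix (Fin 2) (Fin 2) ℝ × ℝ) => pointE z.1.1 z.1.2 z.2.1 z.2.2 := by
  refine continuous_matrix fun i j => ?_
  fin_cases i <;> fin_cases j <;>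
    simp only [Fin.zero_eta, Fin.mk_one, Fin.isValue, pointE_zero_zero, pointE_zero_one,
      pointE_one_zero, pointE_one_one] <;> fun_prop

variable {A B p q}

lemma contDiffOn_pointE {A B : Plane → Matrix (Fin 2) (Fin 2) ℝ} {p q : Plane → ℝ} {Ω : Set Plane}
    (hA : ∀ i j, ContDiffOn ℝ 1 (fun x => A x i j) Ω) (hB : ∀ i j, ContDiffOn ℝ 1 (fun x => B x i j) Ω)
    (hp : ContDiffOn ℝ 1 p Ω) (hq : ContDiffOn ℝ 1 q Ω) (i j : Fin 2) :
    ContDiffOn ℝ 1 (fun x => pointE (A x) (p x) (B x) (q x) i j) Ω := by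
  have a00 := hA 0 0; have a01 := hA 0 1; have a10 := hA 1 0; have a11 := hA 1 1
  have b00 := hB 0 0; have b01 := hB 0 1; have b10 := hB 1 0; have b11 := hB 1 1
  fin_cases i <;> fin_cases j <;>
    simp only [Fin.zero_eta, Fin.mk_one, Fin.isValue, pointE_zero_zero, pointE_zero_one,
      pointE_one_zero, pointE_one_one] <;> fun_prop

/-- The product rule for the bilinear form `pointE`. -/
lemma hasDerivAt_pointE {A B : ℝ → Matrix (Fin 2) (Fin 2) ℝ} {p q : ℝ → ℝ}
    {A' B' : Matrix (Fin 2) (Fin 2) ℝ} {p' q' t : ℝ}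
    (hA : ∀ i j, HasDerivAt (fun t => A t i j) (A' i j) t)
    (hB : ∀ i j, HasDerivAt (fun t => B t i j) (B' i j) t)
    (hp : HasDerivAt p p' t) (hq : HasDerivAt q q' t) (i j : Fin 2) :
    HasDerivAt (fun t => pointE (A t) (p t) (B t) (q t) i j)
      (pointE A' p' (B t) (q t) i j + pointE (A t) (p t) B' q' i j) t := by
  have a00 := hA 0 0; have a01 := hA 0 1; have a10 := hA 1 0; have a11 := hA 1 1
  have b00 := hB 0 0; have b01 := hB 0 1; have b10 := hB 1 0; have b11 := hB 1 1
  fin_cases i <;> fin_cases j <;>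
    simp only [Fin.zero_eta, Fin.mk_one, Fin.isValue, pointE_zero_zero, pointE_zero_one,
      pointE_one_zero, pointE_one_one]
  · exact ((((((a11.const_mul 2).mul b11).add (a01.mul b01)).sub (a10.mul b10)).sub
      ((a00.const_mul 2).mul b00)).sub (hp.mul b11)).sub (hq.mul a11) |>.congr_deriv (by ring)
  · exact ((((((a00.const_mul (-2)).mul b01).sub ((a01.add a10).mul b11)).sub
      ((b00.const_mul 2).mul a01)).sub ((b01.add b10).mul a11)).add (hp.mul b01)).add (hq.mul a01)
        |>.congr_deriv (by simp only [Pi.add_apply]; ring)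
  · exact ((((((a01.add a10).neg).mul b00).sub ((a11.const_mul 2).mul b10)).sub
      ((b01.add b10).mul a00)).sub ((b11.const_mul 2).mul a10)).add (hp.mul b10) |>.add (hq.mul a10)
        |>.congr_deriv (by simp only [Pi.add_apply, Pi.neg_apply]; ring)
  · exact ((((((a00.const_mul 2).mul b00).add (a10.mul b10)).sub (a01.mul b01)).sub
      ((a11.const_mul 2).mul b11)).sub (hp.mul b00)).sub (hq.mul a00) |>.congr_deriv (by ring)

lemma pointE_comm : pointE A p B q = pointE B q A p := by
  ext i j
  fin_cases i <;> fin_cases j <;>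
    simp only [Fin.zero_eta, Fin.mk_one, Fin.isValue, pointE_zero_zero, pointE_zero_one,
      pointE_one_zero, pointE_one_one] <;> ring

/-- The contribution of one Stokes flow to `div E`. Here `A' m` and `p' m` are the derivatives of
its gradient and pressure in the direction `m`. -/
lemma sum_pointE_eq_zero {A' : Fin 2 → Matrix (Fin 2) (Fin 2) ℝ} {p' : Fin 2 → ℝ}
    (hsymm : ∀ k l m, A' m k l = A' l k m) (htr : ∀ m, (A' m).trace = 0)
    (hmom : ∀ k, A' 0 k 0 + A' 1 k 1 = p' k) (hB : B.trace = 0) (j : Fin 2) :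
    ∑ m, pointE (A' m) (p' m) B q m j = 0 := by
  have t0 := htr 0
  have t1 := htr 1
  have s0 := hsymm 0 0 1
  have s1 := hsymm 1 0 1
  have m0 := hmom 0
  have m1 := hmom 1
  simp only [Matrix.trace, Matrix.diag, Fin.sum_univ_two] at t0 t1 hB
  have e0 : A' 0 1 1 = -A' 0 0 0 := by linarith
  have e1 : A' 1 1 1 = -A' 1 0 0 := by linarith
  have hB' : B 1 1 = -B 0 0 := by linarith
  rw [Fin.sum_univ_two]
  fin_cases j <;>
    simp only [Fin.zero_eta, Fin.mk_one, Fin.isValue, pointE_zero_zero, pointE_zero_one,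
      pointE_one_zero, pointE_one_one, ← m0, ← m1, e0, e1, s0, s1, hB'] <;> ring

end PointE

/-! ### The divergence of `E · ζ` for Stokes flows -/

/-- The derivative of `∇u` in the coordinate direction `m`. -/
def gradDeriv (u : Plane → Plane) (x : Plane) (m : Fin 2) : Matrix (Fin 2) (Fin 2) ℝ :=
  Matrix.of fun k l =>
    fderiv ℝ (fderiv ℝ u) x (EuclideanSpace.single m 1) (EuclideanSpace.single l 1) k

lemma hasDerivAt_line {Y : Type*} [NormedAddCommGroup Y] [NormedSpace ℝ Y] {f : Plane → Y}
    {x : Plane} (hf : DifferentiableAt ℝ f x) (w : Plane) :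
    HasDerivAt (fun t : ℝ => f (x + t • w)) (fderiv ℝ f x w) 0 :=
  hf.hasFDerivAt.hasLineDerivAt w

lemma eventually_line_mem {Ω : Set Plane} (hΩ : IsOpen Ω) {x : Plane} (hx : x ∈ Ω) (w : Plane) :
    ∀ᶠ t : ℝ in 𝓝 0, x + t • w ∈ Ω := by
  have : Continuous fun t : ℝ => x + t • w := by fun_prop
  exact this.continuousAt.eventually (hΩ.mem_nhds (by simpa using hx))

lemma hasDerivAt_apply {f : ℝ → Plane} {f' : Plane} {t : ℝ} (hf : HasDerivAt f f' t) (i : Fin 2) :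
    HasDerivAt (fun t => f t i) (f' i) t :=
  hasDerivAt_pi.1 ((PiLp.hasFDerivAt_ofLp 2 _).comp_hasDerivAt t hf) i

lemma hasDerivAt_grad {u : Plane → Plane} {x : Plane} (hu : DifferentiableAt ℝ (fderiv ℝ u) x)
    (m k l : Fin 2) : HasDerivAt (fun t : ℝ => grad u (x + t • EuclideanSpace.single m 1) k l)
      (gradDeriv u x m k l) 0 := by
  have h := (hasDerivAt_line hu (EuclideanSpace.single m 1)).clm_apply
    (hasDerivAt_const (0 : ℝ) (EuclideanSpace.single l (1 : ℝ)))
  simpa [grad, gradDeriv] using hasDerivAt_apply h k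

section Stokes

variable {C : Channel} {u v : Plane → Plane} {p q : Plane → ℝ}

lemma Channel.IsStokes.contDiffOn_grad (h : C.IsStokes u p) (i j : Fin 2) :
    ContDiffOn ℝ 1 (fun x => grad u x i j) C.Ω := by
  have h1 : ContDiffOn ℝ 1 (fderiv ℝ u) C.Ω :=
    h.u_contDiff.fderiv_of_isOpen C.Ω_open (by norm_num)
  have h2 : ContDiffOn ℝ 1 (fun x => fderiv ℝ u x (EuclideanSpace.single j 1)) C.Ω :=
    h1.clm_apply contDiffOn_const
  exact contDiffOn_euclidean.1 h2 i

lemma Channel.IsStokes.differentiableAt_fderiv (h : C.IsStokes u p) {x : Plane} (hx : x ∈ C.Ω) :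
    DifferentiableAt ℝ (fderiv ℝ u) x :=
  ((h.u_contDiff.fderiv_of_isOpen (m := 1) C.Ω_open (by norm_num)).differentiableOn
    one_ne_zero).differentiableAt (C.Ω_open.mem_nhds hx)

lemma Channel.IsStokes.gradDeriv_symm (h : C.IsStokes u p) {x : Plane} (hx : x ∈ C.Ω)
    (k l m : Fin 2) : gradDeriv u x m k l = gradDeriv u x l k m := by
  have := (h.u_contDiff.contDiffAt (C.Ω_open.mem_nhds hx)).isSymmSndFDerivAt (by simp)
  simp only [gradDeriv, Matrix.of_apply]
  rw [this.eq]

lemma Channel.IsStokes.trace_gradDeriv (h : C.IsStokes u p) {x : Plane} (hx : x ∈ C.Ω)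
    (m : Fin 2) : (gradDeriv u x m).trace = 0 := by
  have h1 := (hasDerivAt_grad (h.differentiableAt_fderiv hx) m 0 0).add
    (hasDerivAt_grad (h.differentiableAt_fderiv hx) m 1 1)
  have h2 : HasDerivAt (fun _ : ℝ => (0 : ℝ)) (gradDeriv u x m 0 0 + gradDeriv u x m 1 1) 0 := by
    refine h1.congr_of_eventuallyEq ?_
    filter_upwards [eventually_line_mem C.Ω_open hx (EuclideanSpace.single m 1)] with t ht
    have := h.incompressible _ ht
    rw [div, Matrix.trace_fin_two] at this
    exact this.symm
  rw [Matrix.trace_fin_two]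
  exact h2.unique (hasDerivAt_const _ _)

lemma Channel.IsStokes.momentum_coord (h : C.IsStokes u p) {x : Plane} (hx : x ∈ C.Ω) (k : Fin 2) :
    gradDeriv u x 0 k 0 + gradDeriv u x 1 k 1 = fderiv ℝ p x (EuclideanSpace.single k 1) := by
  have h1 := congrArg (fun w : Plane => w k) (h.momentum x hx)
  rw [InnerProductSpace.laplacian_eq_iteratedFDeriv_orthonormalBasis u
    (EuclideanSpace.basisFun (Fin 2) ℝ)] at h1
  have h2 : gradient p x k = fderiv ℝ p x (EuclideanSpace.single k 1) := by
    have : inner ℝ (gradient p x) (EuclideanSpace.single k (1 : ℝ))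
        = fderiv ℝ p x (EuclideanSpace.single k 1) := by
      simp [gradient]
    rw [EuclideanSpace.inner_single_right, one_mul] at this
    exact this
  simp [iteratedFDeriv_two_apply, h2] at h1
  simp only [gradDeriv, Matrix.of_apply]
  linarith

lemma Channel.IsStokes.trace_grad (h : C.IsStokes u p) {x : Plane} (hx : x ∈ C.Ω) :
    (grad u x).trace = 0 := h.incompressible x hx

/-- The vector field `E · ζ`, continued to the closure of the fluid region by its traces. -/
def fluxField (Ω : Set Plane) (E : Plane → Matrix (Fin 2) (Fin 2) ℝ) (ζ : Plane → Plane)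
    (x : Plane) : Plane :=
  WithLp.toLp 2 (tr Ω E x *ᵥ (ζ x).ofLp)

lemma fluxField_apply (Ω : Set Plane) (E : Plane → Matrix (Fin 2) (Fin 2) ℝ) (ζ : Plane → Plane)
    (x : Plane) (i : Fin 2) :
    fluxField Ω E ζ x i = tr Ω E x i 0 * ζ x 0 + tr Ω E x i 1 * ζ x 1 := by
  fin_cases i <;> simp [fluxField]

lemma Channel.IsStokes.hasTraces_tensorE (h : C.IsStokes u p) (h' : C.IsStokes v q) :
    HasTraces C.Ω (tensorE u p v q) :=
  ((h.grad_trace.prodMk h.p_trace).prodMk (h'.grad_trace.prodMk h'.p_trace)).comp continuous_pointE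

lemma Channel.IsStokes.tr_tensorE (h : C.IsStokes u p) (h' : C.IsStokes v q) {x : Plane}
    (hx : x ∈ closure C.Ω) : tr C.Ω (tensorE u p v q) x
      = pointE (tr C.Ω (grad u) x) (tr C.Ω p x) (tr C.Ω (grad v) x) (tr C.Ω q x) := by
  have := ((h.grad_trace.prodMk h.p_trace).prodMk (h'.grad_trace.prodMk h'.p_trace)).tr_comp
    continuous_pointE hx
  rw [HasTraces.tr_prodMk (h.grad_trace.prodMk h.p_trace) (h'.grad_trace.prodMk h'.p_trace) hx,
    HasTraces.tr_prodMk h.grad_trace h.p_trace hx,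
    HasTraces.tr_prodMk h'.grad_trace h'.p_trace hx] at this
  exact this

lemma Channel.IsStokes.contDiffOn_tensorE (h : C.IsStokes u p) (h' : C.IsStokes v q)
    (i j : Fin 2) : ContDiffOn ℝ 1 (fun x => tensorE u p v q x i j) C.Ω :=
  contDiffOn_pointE h.contDiffOn_grad h'.contDiffOn_grad h.p_contDiff h'.p_contDiff i j

lemma Channel.IsStokes.tr_tensorE_eq (h : C.IsStokes u p) (h' : C.IsStokes v q) :
    EqOn (tr C.Ω (tensorE u p v q)) (tensorE u p v q) C.Ω := fun _ hx =>
  tr_eq_self (continuousOn_pi.2 fun i => continuousOn_pi.2 fun j =>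
    (h.contDiffOn_tensorE h' i j).continuousOn) hx

lemma Channel.IsStokes.contDiffOn_fluxField (h : C.IsStokes u p) (h' : C.IsStokes v q)
    {ζ : Plane → Plane} (hζ : ContDiff ℝ 1 ζ) :
    ContDiffOn ℝ 1 (fluxField C.Ω (tensorE u p v q) ζ) C.Ω := by
  refine contDiffOn_euclidean.2 fun i => ?_
  have hζi : ∀ j, ContDiffOn ℝ 1 (fun x => ζ x j) C.Ω := fun j =>
    (contDiff_euclidean.1 hζ j).contDiffOn
  refine (((h.contDiffOn_tensorE h' i 0).mul (hζi 0)).add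
    ((h.contDiffOn_tensorE h' i 1).mul (hζi 1))).congr fun x hx => ?_
  rw [fluxField_apply, h.tr_tensorE_eq h' hx]

/-- In the fluid `E` is divergence free, so that `div (E · ζ) = E : ∇ᵀζ`. -/
lemma Channel.IsStokes.div_fluxField (h : C.IsStokes u p) (h' : C.IsStokes v q)
    {ζ : Plane → Plane} (hζ : ContDiff ℝ 1 ζ) {x : Plane} (hx : x ∈ C.Ω) :
    div (fluxField C.Ω (tensorE u p v q) ζ) x = ddot (tensorE u p v q x) (grad ζ x)ᵀ := by
  have hF : DifferentiableAt ℝ (fluxField C.Ω (tensorE u p v q) ζ) x :=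
    ((h.contDiffOn_fluxField h' hζ).differentiableOn one_ne_zero).differentiableAt
      (C.Ω_open.mem_nhds hx)
  have hp : DifferentiableAt ℝ p x :=
    (h.p_contDiff.differentiableOn one_ne_zero).differentiableAt (C.Ω_open.mem_nhds hx)
  have hq : DifferentiableAt ℝ q x :=
    (h'.p_contDiff.differentiableOn one_ne_zero).differentiableAt (C.Ω_open.mem_nhds hx)
  set A' := gradDeriv u x with hA'
  set B' := gradDeriv v x with hB'
  set p' : Fin 2 → ℝ := fun m => fderiv ℝ p x (EuclideanSpace.single m 1) with hp'
  set q' : Fin 2 → ℝ := fun m => fderiv ℝ q x (EuclideanSpace.single m 1) with hq'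
  have hE : ∀ m i j, HasDerivAt
      (fun t : ℝ => tensorE u p v q (x + t • EuclideanSpace.single m 1) i j)
      (pointE (A' m) (p' m) (grad v x) (q x) i j + pointE (grad u x) (p x) (B' m) (q' m) i j) 0 := by
    intro m i j
    have := hasDerivAt_pointE (hasDerivAt_grad (h.differentiableAt_fderiv hx) m)
      (hasDerivAt_grad (h'.differentiableAt_fderiv hx) m)
      (hasDerivAt_line hp (EuclideanSpace.single m 1))
      (hasDerivAt_line hq (EuclideanSpace.single m 1)) i j
    simp only [zero_smul, add_zero] at this
    exact this
  have hζ' : ∀ m j, HasDerivAt (fun t : ℝ => ζ (x + t • EuclideanSpace.single m 1) j)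
      (grad ζ x j m) 0 := fun m j =>
    hasDerivAt_apply (hasDerivAt_line (hζ.differentiable one_ne_zero x) _) j
  have hdiag : ∀ m, fderiv ℝ (fluxField C.Ω (tensorE u p v q) ζ) x (EuclideanSpace.single m 1) m
      = ∑ j, ((pointE (A' m) (p' m) (grad v x) (q x) m j
          + pointE (grad u x) (p x) (B' m) (q' m) m j) * ζ x j
        + tensorE u p v q x m j * grad ζ x j m) := by
    intro m
    have h1 := hasDerivAt_apply (hasDerivAt_line hF (EuclideanSpace.single m 1)) m
    have h2 := ((hE m m 0).mul (hζ' m 0)).add ((hE m m 1).mul (hζ' m 1))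
    simp only [zero_smul, add_zero] at h2
    rw [Fin.sum_univ_two]
    refine h1.unique (h2.congr_of_eventuallyEq ?_)
    filter_upwards [eventually_line_mem C.Ω_open hx (EuclideanSpace.single m 1)] with t ht
    rw [fluxField_apply, h.tr_tensorE_eq h' ht]
    rfl
  have z1 := sum_pointE_eq_zero (A' := A') (p' := p') (B := grad v x) (q := q x)
    (fun k l m => h.gradDeriv_symm hx k l m) (h.trace_gradDeriv hx) (h.momentum_coord hx)
    (h'.trace_grad hx)
  have z2 := sum_pointE_eq_zero (A' := B') (p' := q') (B := grad u x) (q := p x)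
    (fun k l m => h'.gradDeriv_symm hx k l m) (h'.trace_gradDeriv hx) (h'.momentum_coord hx)
    (h.trace_grad hx)
  have z10 := z1 0
  have z11 := z1 1
  have z20 := z2 0
  have z21 := z2 1
  simp only [Fin.sum_univ_two, pointE_comm (B := grad u x)] at z10 z11 z20 z21
  rw [div_eq, hdiag, hdiag]
  simp only [ddot, Fin.sum_univ_two, Matrix.transpose_apply]
  linear_combination ζ x 0 * z10 + ζ x 1 * z11 + ζ x 0 * z20 + ζ x 1 * z21

lemma Channel.IsStokes.isFluxField (h : C.IsStokes u p) (h' : C.IsStokes v q)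
    {ζ : Plane → Plane} (hζ : ContDiff ℝ 1 ζ) :
    IsFluxField C.Ω (fluxField C.Ω (tensorE u p v q) ζ) := by
  have hE : ∀ i j, ContinuousOn (fun x => tr C.Ω (tensorE u p v q) x i j) (closure C.Ω) :=
    fun i j => continuousOn_pi.1 (continuousOn_pi.1 (h.hasTraces_tensorE h').continuousOn_tr i) j
  have hζc : ∀ j, Continuous fun x => ζ x j := fun j => (contDiff_euclidean.1 hζ j).continuous
  refine ⟨?_, h.contDiffOn_fluxField h' hζ, ?_⟩
  · refine (PiLp.continuous_toLp 2 _).comp_continuousOn (continuousOn_pi.2 fun i => ?_)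
    simp only [Matrix.mulVec, dotProduct, Fin.sum_univ_two]
    exact ((hE i 0).mul (hζc 0).continuousOn).add ((hE i 1).mul (hζc 1).continuousOn)
  · have hg : ∀ i j, Continuous fun x => grad ζ x i j := fun i j => by
      have h1 : Continuous fun x => fderiv ℝ ζ x (EuclideanSpace.single j 1) :=
        (hζ.continuous_fderiv one_ne_zero).clm_apply continuous_const
      exact (continuous_apply i).comp ((PiLp.continuous_ofLp 2 _).comp h1)
    have hcont : ContinuousOn (fun x => ddot (tr C.Ω (tensorE u p v q) x) (grad ζ x)ᵀ)
        (closure C.Ω) := by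
      simp only [ddot, Matrix.transpose_apply]
      exact continuousOn_finsetSum _ fun i _ => continuousOn_finsetSum _ fun j _ =>
        (hE i j).mul (hg j i).continuousOn
    refine ((hcont.integrableOn_compact C.Ω_bounded.isCompact_closure).mono_set
      subset_closure).congr_fun (fun x hx => ?_) C.Ω_open.measurableSet
    simp only [h.div_fluxField h' hζ hx, h.tr_tensorE_eq h' hx]

end Stokes

/-! ### The boundary of the fluid region -/

lemma cross_eq_rotate (a b : Plane) : cross a b = (rotate a).ofLp ⬝ᵥ b.ofLp := by
  rw [dotProduct, Fin.sum_univ_two]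
  rw [rotate_zero, rotate_one, cross]; ring

lemma hasDerivAt_vertical (x₀ y σ : ℝ) (s : ℝ) :
    HasDerivAt (fun s => (!₂[x₀, y + σ * s] : Plane)) !₂[0, σ] s := by
  have : (fun s : ℝ => (!₂[x₀, y + σ * s] : Plane))
      = fun s => !₂[x₀, y] + s • (!₂[0, σ] : Plane) := by
    funext s; ext i; fin_cases i <;> simp [mul_comm]
  rw [this]
  simpa using ((hasDerivAt_id s).smul_const (!₂[0, σ] : Plane)).const_add (!₂[x₀, y] : Plane)

lemma contDiff_vertical (x₀ y σ : ℝ) : ContDiff ℝ 1 (fun s => (!₂[x₀, y + σ * s] : Plane)) := by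
  refine contDiff_euclidean.2 fun i => ?_
  fin_cases i <;> simp <;> fun_prop

lemma deriv_comp_const_sub' (f : ℝ → Plane) (a s : ℝ) :
    deriv (fun s => f (a - s)) s = -deriv f (a - s) := by
  simpa using deriv_comp_const_sub (f := f) a s

lemma rotate_neg (a : Plane) : rotate (-a) = -rotate a := by
  ext i; fin_cases i <;> simp [rotate_zero, rotate_one]

namespace Channel

variable (C : Channel)

/-- The boundary arcs of the fluid region: the upper wall (reversed, so that `r · c'` points
outwards), the lower wall, the particle contour and the end sections `Γ_L`, `Γ₀`. -/
def arc : Fin 5 → ℝ → Plane :=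
  ![fun s => C.xp (C.ℓp - s), C.xm, C.xc, fun s => !₂[C.L, C.b + (-1) * s],
    fun s => !₂[0, C.a + 1 * s]]

/-- The parameter lengths of the boundary arcs. -/
def arcLength : Fin 5 → ℝ := ![C.ℓp, C.ℓm, C.ℓc, C.b - C.a, C.b - C.a]

lemma xp_end : C.xp C.ℓp = !₂[0, C.b] := by
  have := C.xp_period 0
  rw [zero_add, C.xp_zero] at this
  rw [this]; ext i; fin_cases i <;> simp [e₁]

lemma xm_end : C.xm C.ℓm = !₂[0, C.a] := by
  have := C.xm_period 0
  rw [zero_add, C.xm_zero] at this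
  rw [this]; ext i; fin_cases i <;> simp [e₁]

/-- By periodicity the upper wall meets `Γ₀` at its endpoint only. -/
lemma xp_section_zero {s : ℝ} (h0 : C.xp s 0 = 0) (h1 : C.xp s 1 ∈ Icc C.a C.b) : s = C.ℓp := by
  have h := C.xp_period (s - C.ℓp)
  rw [sub_add_cancel] at h
  have e0 : C.xp s 0 = C.xp (s - C.ℓp) 0 - C.L := by rw [h]; simp [e₁]
  have e1 : C.xp s 1 = C.xp (s - C.ℓp) 1 := by rw [h]; simp [e₁]
  linarith [C.xp_section (s - C.ℓp) (by linarith) (e1 ▸ h1)]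

/-- By periodicity the lower wall meets `Γ₀` at its endpoint only. -/
lemma xm_section_zero {s : ℝ} (h0 : C.xm s 0 = 0) (h1 : C.xm s 1 ∈ Icc C.a C.b) : s = C.ℓm := by
  have h := C.xm_period (s - C.ℓm)
  rw [sub_add_cancel] at h
  have e0 : C.xm s 0 = C.xm (s - C.ℓm) 0 - C.L := by rw [h]; simp [e₁]
  have e1 : C.xm s 1 = C.xm (s - C.ℓm) 1 := by rw [h]; simp [e₁]
  linarith [C.xm_section (s - C.ℓm) (by linarith) (e1 ▸ h1)]

lemma xc_simple {s t : ℝ} (hs : s ∈ Ioo 0 C.ℓc) (ht : t ∈ Icc 0 C.ℓc) (h : C.xc s = C.xc t) :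
    s = t := by
  rcases ht.2.eq_or_lt with rfl | ht'
  · have h0 : C.xc C.ℓc = C.xc 0 := by simpa using C.xc_period 0
    exact absurd (C.xc_inj ⟨hs.1.le, hs.2⟩ ⟨le_rfl, C.ℓc_pos⟩ (h.trans h0)) hs.1.ne'
  · exact C.xc_inj ⟨hs.1.le, hs.2⟩ ⟨ht.1, ht'⟩ h

lemma range_xc : range C.xc = C.xc '' Icc 0 C.ℓc := by
  refine Subset.antisymm ?_ (image_subset_range _ _)
  have hper : Function.Periodic C.xc C.ℓc := C.xc_period
  rintro _ ⟨s, rfl⟩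
  obtain ⟨t, ht, hst⟩ := hper.exists_mem_Ico₀ C.ℓc_pos s
  exact ⟨t, Ico_subset_Icc_self ht, hst.symm⟩

lemma arc_frontier : frontier C.Ω = ⋃ i, C.arc i '' Icc 0 (C.arcLength i) := by
  rw [C.Ω_frontier, C.range_xc]
  have h0 : C.xp '' Icc 0 C.ℓp = (fun s => C.xp (C.ℓp - s)) '' Icc 0 C.ℓp := by
    rw [← image_image C.xp (fun s => C.ℓp - s)]
    simp
  have h3 : {x : Plane | x 0 = C.L ∧ x 1 ∈ Icc C.a C.b}
      = (fun s => !₂[C.L, C.b + (-1) * s]) '' Icc 0 (C.b - C.a) := by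
    ext x
    constructor
    · rintro ⟨hx0, hx1⟩
      refine ⟨C.b - x 1, ⟨by linarith [hx1.2], by linarith [hx1.1]⟩, ?_⟩
      ext i; fin_cases i <;> simp [hx0]
    · rintro ⟨s, hs, rfl⟩
      exact ⟨by simp, by simp; constructor <;> linarith [hs.1, hs.2]⟩
  have h4 : {x : Plane | x 0 = 0 ∧ x 1 ∈ Icc C.a C.b}
      = (fun s => !₂[0, C.a + 1 * s]) '' Icc 0 (C.b - C.a) := by
    ext x
    constructor
    · rintro ⟨hx0, hx1⟩
      refine ⟨x 1 - C.a, ⟨by linarith [hx1.1], by linarith [hx1.2]⟩, ?_⟩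
      ext i; fin_cases i <;> simp [hx0]
    · rintro ⟨s, hs, rfl⟩
      exact ⟨by simp, by simp; constructor <;> linarith [hs.1, hs.2]⟩
  rw [h0, h3, h4]
  ext x
  constructor
  · rintro ((((h | h) | h) | h) | h)
    exacts [mem_iUnion.2 ⟨0, h⟩, mem_iUnion.2 ⟨1, h⟩, mem_iUnion.2 ⟨2, h⟩, mem_iUnion.2 ⟨4, h⟩,
      mem_iUnion.2 ⟨3, h⟩]
  · intro h
    obtain ⟨i, h⟩ := mem_iUnion.1 h
    fin_cases i
    exacts [Or.inl (Or.inl (Or.inl (Or.inl h))), Or.inl (Or.inl (Or.inl (Or.inr h))),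
      Or.inl (Or.inl (Or.inr h)), Or.inr h, Or.inl (Or.inr h)]

lemma arc_simple (i j : Fin 5) (s : ℝ) (hs : s ∈ Ioo 0 (C.arcLength i)) (t : ℝ)
    (ht : t ∈ Icc 0 (C.arcLength j)) (h : C.arc i s = C.arc j t) : i = j ∧ s = t := by
  have hab := C.a_lt_b
  have hL := C.L_pos
  fin_cases i <;> fin_cases j <;> simp [arc, arcLength] at hs ht h ⊢
  · linarith [C.xp_inj h]
  · exact C.xp_ne_xm _ _ h
  · exact C.xc_ne_xp _ _ h.symm
  · have := C.xp_section _ (by rw [h]; simp) (by rw [h]; simp; constructor <;> linarith)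
    linarith
  · have := C.xp_section_zero (s := C.ℓp - s) (by rw [h]; simp)
      (by rw [h]; simp; constructor <;> linarith)
    linarith
  · exact C.xp_ne_xm _ _ h.symm
  · exact C.xm_inj h
  · exact C.xc_ne_xm _ _ h.symm
  · have := C.xm_section _ (by rw [h]; simp) (by rw [h]; simp; constructor <;> linarith)
    linarith
  · have := C.xm_section_zero (by rw [h]; simp) (by rw [h]; simp; constructor <;> linarith)
    linarith
  · exact C.xc_ne_xp _ _ h
  · exact C.xc_ne_xm _ _ h
  · exact C.xc_simple hs ht h
  · exact C.xc_section s (Or.inr (by rw [h]; simp)) (by rw [h]; simp; constructor <;> linarith)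
  · exact C.xc_section s (Or.inl (by rw [h]; simp)) (by rw [h]; simp; constructor <;> linarith)
  · have h' := C.xp_section (C.ℓp - t) (by rw [← h]; simp)
      (by rw [← h]; simp; constructor <;> linarith)
    rw [h', C.xp_zero] at h
    have := congrArg (fun x : Plane => x 1) h
    simp at this
    linarith
  · have h' := C.xm_section t (by rw [← h]; simp) (by rw [← h]; simp; constructor <;> linarith)
    rw [h', C.xm_zero] at h
    have := congrArg (fun x : Plane => x 1) h
    simp at this
    linarith
  · exact C.xc_section t (Or.inr (by rw [← h]; simp)) (by rw [← h]; simp; constructor <;> linarith)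
  · exact h
  · linarith [h.1]
  · have h' := C.xp_section_zero (s := C.ℓp - t) (by rw [← h]; simp)
      (by rw [← h]; simp; constructor <;> linarith)
    rw [h', C.xp_end] at h
    have := congrArg (fun x : Plane => x 1) h
    simp at this
    linarith
  · have h' := C.xm_section_zero (s := t) (by rw [← h]; simp)
      (by rw [← h]; simp; constructor <;> linarith)
    rw [h', C.xm_end] at h
    have := congrArg (fun x : Plane => x 1) h
    simp at this
    linarith
  · exact C.xc_section t (Or.inl (by rw [← h]; simp)) (by rw [← h]; simp; constructor <;> linarith)
  · linarith [h.1]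
  · exact h

lemma arc_regular_outward (i : Fin 5) (s : ℝ) (hs : s ∈ Ioo 0 (C.arcLength i)) :
    deriv (C.arc i) s ≠ 0 ∧ IsOutward C.Ω (C.arc i s) (rotate (deriv (C.arc i) s)) := by
  have hunit : ∀ {v : Plane}, ‖v‖ = 1 → v ≠ 0 := fun hv h0 => by simp [h0] at hv
  fin_cases i <;> simp only [arc, arcLength, Fin.zero_eta, Fin.mk_one, Fin.reduceFinMk,
    Matrix.cons_val] at hs ⊢
  · rw [deriv_comp_const_sub', rotate_neg]
    exact ⟨neg_ne_zero.2 (hunit (C.xp_unit _)),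
      C.outward_p _ ⟨by linarith [hs.2], by linarith [hs.1]⟩⟩
  · exact ⟨hunit (C.xm_unit _), C.outward_m _ hs⟩
  · exact ⟨hunit (C.xc_unit _), C.outward_c _⟩
  · rw [(hasDerivAt_vertical _ _ _ _).deriv]
    refine ⟨fun h => by simpa using congrArg (fun x : Plane => x 1) h, ?_⟩
    convert C.outward_L (C.b + (-1) * s) ⟨by linarith [hs.2], by linarith [hs.1]⟩ using 1
    ext i; fin_cases i <;> simp [rotate_zero, rotate_one, e₁]
  · rw [(hasDerivAt_vertical _ _ _ _).deriv]
    refine ⟨fun h => by simpa using congrArg (fun x : Plane => x 1) h, ?_⟩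
    convert C.outward_0 (C.a + 1 * s) ⟨by linarith [hs.1], by linarith [hs.2]⟩ using 1
    ext i; fin_cases i <;> simp [rotate_zero, rotate_one, e₁]

lemma isPiecewiseBoundary : IsPiecewiseBoundary C.Ω C.arc C.arcLength where
  pos i := by
    have := C.a_lt_b
    fin_cases i <;> simp [arcLength, C.ℓp_pos, C.ℓm_pos, C.ℓc_pos, this]
  contDiff i := by
    fin_cases i
    · exact C.xp_contDiff.comp (contDiff_const.sub contDiff_id)
    · exact C.xm_contDiff
    · exact C.xc_contDiff
    · exact contDiff_vertical _ _ _
    · exact contDiff_vertical _ _ _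
  regular i s hs := (C.arc_regular_outward i s hs).1
  frontier_eq := C.arc_frontier
  simple := C.arc_simple
  outward i s hs := (C.arc_regular_outward i s hs).2

/-- The flux through the boundary of the fluid region, split into the walls and contour and the two
end sections. -/
lemma flux_arc (E : Plane → Matrix (Fin 2) (Fin 2) ℝ) (ζ : Plane → Plane) :
    flux C.arc C.arcLength (fluxField C.Ω E ζ)
      = C.boundaryIntegral (tr C.Ω E) ζ
        + ((∫ y in C.a..C.b, fluxField C.Ω E ζ !₂[C.L, y] 0)
          - ∫ y in C.a..C.b, fluxField C.Ω E ζ !₂[0, y] 0) := by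
  simp only [flux, Fin.sum_univ_five, arc, arcLength, Matrix.cons_val]
  have h0 : ∫ s in (0 : ℝ)..C.ℓp, cross (deriv (fun s => C.xp (C.ℓp - s)) s)
      (fluxField C.Ω E ζ (C.xp (C.ℓp - s)))
      = ∫ s in (0 : ℝ)..C.ℓp, (C.np s).ofLp ⬝ᵥ (tr C.Ω E (C.xp s) *ᵥ (ζ (C.xp s)).ofLp) := by
    have := intervalIntegral.integral_comp_sub_left (a := 0) (b := C.ℓp)
      (fun s => (C.np s).ofLp ⬝ᵥ (tr C.Ω E (C.xp s) *ᵥ (ζ (C.xp s)).ofLp)) C.ℓp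
    rw [sub_self, sub_zero] at this
    rw [← this]
    simp only [deriv_comp_const_sub', cross_eq_rotate, rotate_neg, np, fluxField]
  have h3 : ∫ s in (0 : ℝ)..(C.b - C.a), cross (deriv (fun s => (!₂[C.L, C.b + (-1) * s] : Plane)) s)
      (fluxField C.Ω E ζ !₂[C.L, C.b + (-1) * s])
      = ∫ y in C.a..C.b, fluxField C.Ω E ζ !₂[C.L, y] 0 := by
    have := intervalIntegral.integral_comp_sub_left (a := 0) (b := C.b - C.a)
      (fun y => fluxField C.Ω E ζ !₂[C.L, y] 0) C.b
    rw [sub_sub_cancel, sub_zero] at this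
    rw [← this]
    simp only [(hasDerivAt_vertical _ _ _ _).deriv, cross]
    simp [sub_eq_add_neg]
  have h4 : ∫ s in (0 : ℝ)..(C.b - C.a), cross (deriv (fun s => (!₂[0, C.a + 1 * s] : Plane)) s)
      (fluxField C.Ω E ζ !₂[0, C.a + 1 * s])
      = -∫ y in C.a..C.b, fluxField C.Ω E ζ !₂[0, y] 0 := by
    have := intervalIntegral.integral_comp_add_left (a := 0) (b := C.b - C.a)
      (fun y => fluxField C.Ω E ζ !₂[0, y] 0) C.a
    rw [add_sub_cancel, add_zero] at this
    rw [← this, ← intervalIntegral.integral_neg]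
    simp only [(hasDerivAt_vertical _ _ _ _).deriv, cross]
    simp
  rw [h0, h3, h4, boundaryIntegral]
  simp only [cross_eq_rotate, fluxField, nm, nc, τc]
  ring

end Channel

/-! ### Periodicity and the flux through the end sections -/

namespace Channel

variable {C : Channel}

lemma arc_tube_box (i : Fin 5) {s₀ : ℝ} (hs₀ : s₀ ∈ Ioo 0 (C.arcLength i)) :
    ∃ η, 0 < η ∧ ∀ z ∈ box s₀ η, 0 < z.2 →
      tube (C.arc i) (rotate (deriv (C.arc i) s₀)) z ∈ C.Ω := by
  have h := C.isPiecewiseBoundary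
  obtain ⟨η, hη, -, -, -, hin, -⟩ := exists_tube_box C.Ω_open (h.contDiff i) (h.regular i s₀ hs₀)
    (h.outward i s₀ hs₀) (h.eventually_frontier i hs₀) one_pos
  exact ⟨η, hη, hin⟩

/-- To the left of an interior point of `Γ_L` lies a whole rectangle of fluid. -/
lemma exists_fluid_left {y : ℝ} (hy : y ∈ Ioo C.a C.b) :
    ∃ η, 0 < η ∧ ∀ x : Plane, C.L - η < x 0 → x 0 < C.L → |x 1 - y| < η → x ∈ C.Ω := by
  obtain ⟨η, hη, h⟩ := arc_tube_box (C := C) 3 (s₀ := C.b - y)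
    ⟨by linarith [hy.2], by simp [arcLength]; linarith [hy.1]⟩
  refine ⟨η, hη, fun x h0 h0' h1 => ?_⟩
  rw [abs_lt] at h1
  have hmem := h (C.b - x 1, C.L - x 0)
    (by rw [mem_box]; constructor <;> constructor <;> simp <;> linarith) (by simpa using h0')
  convert hmem using 1
  have hd : deriv (C.arc 3) (C.b - y) = !₂[0, -1] := (hasDerivAt_vertical _ _ _ _).deriv
  rw [tube, hd]
  ext i; fin_cases i <;> simp [arc, rotate_zero, rotate_one]

/-- To the right of an interior point of `Γ₀` lies a whole rectangle of fluid. -/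
lemma exists_fluid_right {y : ℝ} (hy : y ∈ Ioo C.a C.b) :
    ∃ η, 0 < η ∧ ∀ x : Plane, 0 < x 0 → x 0 < η → |x 1 - y| < η → x ∈ C.Ω := by
  obtain ⟨η, hη, h⟩ := arc_tube_box (C := C) 4 (s₀ := y - C.a)
    ⟨by linarith [hy.1], by simp [arcLength]; linarith [hy.2]⟩
  refine ⟨η, hη, fun x h0 h0' h1 => ?_⟩
  rw [abs_lt] at h1
  have hmem := h (x 1 - C.a, x 0)
    (by rw [mem_box]; constructor <;> constructor <;> simp <;> linarith) h0
  convert hmem using 1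
  have hd : deriv (C.arc 4) (y - C.a) = !₂[0, 1] := (hasDerivAt_vertical _ _ _ _).deriv
  rw [tube, hd]
  ext i; fin_cases i <;> simp [arc, rotate_zero, rotate_one]

lemma subset_whole : C.Ω ⊆ C.whole := fun x hx => ⟨0, x, Or.inl hx, by simp⟩

lemma add_mem_whole {x : Plane} (hx : x ∈ C.Ω) : x + C.L • e₁ ∈ C.whole :=
  ⟨1, x, Or.inl hx, by simp⟩

lemma section_mem_whole {y : ℝ} (hy : y ∈ Ioo C.a C.b) : !₂[C.L, y] ∈ C.whole :=
  ⟨0, !₂[C.L, y], Or.inr ⟨by simp, by simpa using hy⟩, by simp⟩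

/-- The whole channel is a neighbourhood of each interior point of the end section. -/
lemma whole_mem_nhds {y : ℝ} (hy : y ∈ Ioo C.a C.b) : C.whole ∈ 𝓝 (!₂[C.L, y] : Plane) := by
  obtain ⟨η₁, hη₁, hl⟩ := exists_fluid_left hy
  obtain ⟨η₂, hη₂, hr⟩ := exists_fluid_right hy
  have c0 : Continuous fun x : Plane => x 0 := by fun_prop
  have c1 : Continuous fun x : Plane => x 1 := by fun_prop
  have c1' : Continuous fun x : Plane => |x 1 - y| := by fun_prop
  filter_upwards [c0.continuousAt.eventually (Ioo_mem_nhds (a := C.L - η₁) (b := C.L + η₂)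
      (by simpa using hη₁) (by simpa using hη₂)),
    c1.continuousAt.eventually (Ioo_mem_nhds (a := C.a) (b := C.b)
      (by simpa using hy.1) (by simpa using hy.2)),
    c1'.continuousAt.eventually (gt_mem_nhds
      (show |(!₂[C.L, y] : Plane) 1 - y| < min η₁ η₂ by simp [hη₁, hη₂]))]
    with x h0 h1 h1'
  rcases lt_trichotomy (x 0) C.L with h | h | h
  · exact subset_whole (hl x h0.1 h (h1'.trans_le (min_le_left _ _)))
  · exact ⟨0, x, Or.inr ⟨h, h1⟩, by simp⟩
  · have hx : x - C.L • e₁ ∈ C.Ω := hr _ (by simpa [e₁] using h)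
      (by simp [e₁]; linarith [h0.2]) (by simpa [e₁] using h1'.trans_le (min_le_right _ _))
    simpa using add_mem_whole hx

lemma section_mem_closure {y : ℝ} (hy : y ∈ Icc C.a C.b) : (!₂[C.L, y] : Plane) ∈ closure C.Ω := by
  refine frontier_subset_closure ?_
  rw [C.Ω_frontier]
  exact Or.inr ⟨by simp, by simpa using hy⟩

lemma section_zero_mem_closure {y : ℝ} (hy : y ∈ Icc C.a C.b) :
    (!₂[0, y] : Plane) ∈ closure C.Ω := by
  refine frontier_subset_closure ?_
  rw [C.Ω_frontier]
  exact Or.inl (Or.inr ⟨by simp, by simpa using hy⟩)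

/-- The traces of a periodic quantity on the two end sections agree. -/
lemma tr_section_eq {Y : Type*} [TopologicalSpace Y] [T2Space Y] {f : Plane → Y} {y : ℝ}
    (hy : y ∈ Ioo C.a C.b) (hf : ContinuousWithinAt f C.whole !₂[C.L, y])
    (hper : ∀ x ∈ C.Ω, f (x + C.L • e₁) = f x) :
    tr C.Ω f !₂[C.L, y] = tr C.Ω f !₂[0, y] := by
  have hy' := Ioo_subset_Icc_self hy
  rw [tr_eq_of_tendsto (section_mem_closure hy') (hf.tendsto.mono_left
    (nhdsWithin_mono _ subset_whole)), eq_comm]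
  refine tr_eq_of_tendsto (section_zero_mem_closure hy') ?_
  have hshift : Tendsto (fun x : Plane => x + C.L • e₁) (𝓝[C.Ω] !₂[0, y])
      (𝓝[C.whole] !₂[C.L, y]) := by
    refine tendsto_nhdsWithin_iff.2 ⟨?_, ?_⟩
    · have : Continuous fun x : Plane => x + C.L • e₁ := by fun_prop
      have h0 : (!₂[0, y] : Plane) + C.L • e₁ = !₂[C.L, y] := by
        ext i; fin_cases i <;> simp [e₁]
      exact h0 ▸ this.continuousAt.tendsto.mono_left nhdsWithin_le_nhds
    · filter_upwards [self_mem_nhdsWithin] with x hx using add_mem_whole hx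
  exact (hf.tendsto.comp hshift).congr' (by
    filter_upwards [self_mem_nhdsWithin] with x hx using hper x hx)

lemma continuous_proj (i : Fin 2) : Continuous fun x : Plane => x i :=
  (continuous_apply i).comp (PiLp.continuous_ofLp 2 _)

lemma IsPeriodicVelocity.tr_grad_section {u : Plane → Plane} (hu : C.IsPeriodicVelocity u) {y : ℝ}
    (hy : y ∈ Ioo C.a C.b) : tr C.Ω (grad u) !₂[C.L, y] = tr C.Ω (grad u) !₂[0, y] := by
  refine tr_section_eq hy (ContinuousAt.continuousWithinAt ?_) fun x hx => ?_
  · have h1 : ContinuousAt (fderiv ℝ u) !₂[C.L, y] :=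
      ((hu.contDiff.mono interior_subset).continuousOn_fderiv_of_isOpen isOpen_interior
        le_rfl).continuousAt (isOpen_interior.mem_nhds (mem_interior_iff_mem_nhds.2
          (whole_mem_nhds hy)))
    refine continuousAt_pi.2 fun i => continuousAt_pi.2 fun j => ?_
    exact (continuous_proj i).continuousAt.comp (h1.clm_apply continuousAt_const)
  · have h1 : (fun z => u (z + C.L • e₁)) =ᶠ[𝓝 x] u := by
      filter_upwards [C.Ω_open.mem_nhds hx] with z hz using hu.periodic z (subset_whole hz)
    have h2 := h1.fderiv_eq (𝕜 := ℝ)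
    rw [fderiv_comp_add_right] at h2
    simp only [grad, h2]

lemma IsPeriodicPressure.tr_section {p : Plane → ℝ} (hp : C.IsPeriodicPressure p) {y : ℝ}
    (hy : y ∈ Ioo C.a C.b) : tr C.Ω p !₂[C.L, y] = tr C.Ω p !₂[0, y] :=
  tr_section_eq hy (hp.continuousOn _ (section_mem_whole hy)) fun _ hx =>
    hp.periodic _ (subset_whole hx)

/-- Across the end sections only the pressure jump of the second flow contributes to the flux. -/
lemma IsStokes.fluxField_section {u v : Plane → Plane} {p q : Plane → ℝ} {Ωall : Set Plane}
    {ζ : Plane → Plane} (hup : C.IsStokes u p) (hvq : C.IsStokes v q)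
    (hu : C.IsPeriodicVelocity u) (hv : C.IsPeriodicVelocity v) (hp : C.IsPeriodicPressure p)
    (hζ : C.IsTestField Ωall ζ) {y : ℝ} (hy : y ∈ Ioo C.a C.b) :
    fluxField C.Ω (tensorE u p v q) ζ !₂[C.L, y] 0 - fluxField C.Ω (tensorE u p v q) ζ !₂[0, y] 0
      = C.jump q y * tr C.Ω (grad u) !₂[C.L, y] 0 1 * ζ !₂[C.L, y] 1 := by
  have hy' := Ioo_subset_Icc_self hy
  have hax := hζ.axial y hy'
  rw [hζ.periodic y hy'] at hax
  rw [fluxField_apply, fluxField_apply, hζ.periodic y hy', hax,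
    hup.tr_tensorE hvq (section_mem_closure hy'), hup.tr_tensorE hvq (section_zero_mem_closure hy'),
    ← hu.tr_grad_section hy, ← hv.tr_grad_section hy, ← hp.tr_section hy, jump,
    pointE_zero_one, pointE_zero_one]
  ring

lemma IsStokes.integral_tensorE {u v : Plane → Plane} {p q : Plane → ℝ} {Ωall : Set Plane}
    {ζ : Plane → Plane} (hup : C.IsStokes u p) (hvq : C.IsStokes v q)
    (hu : C.IsPeriodicVelocity u) (hv : C.IsPeriodicVelocity v) (hp : C.IsPeriodicPressure p)
    (hζ : C.IsTestField Ωall ζ) :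
    ∫ x in C.Ω, ddot (tensorE u p v q x) (grad ζ x)ᵀ =
      C.boundaryIntegral (tr C.Ω (tensorE u p v q)) ζ
        + ∫ y in C.a..C.b, C.jump q y * tr C.Ω (grad u) !₂[C.L, y] 0 1 * ζ !₂[C.L, y] 1 := by
  have hF := hup.isFluxField hvq hζ.contDiff
  have hab := C.a_lt_b.le
  have hcont : ∀ x₀ : ℝ, (∀ y ∈ Icc C.a C.b, (!₂[x₀, y] : Plane) ∈ closure C.Ω) →
      IntervalIntegrable (fun y => fluxField C.Ω (tensorE u p v q) ζ !₂[x₀, y] 0) volume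
        C.a C.b := by
    intro x₀ hx₀
    refine ContinuousOn.intervalIntegrable ?_
    rw [uIcc_of_le hab]
    have hc : Continuous fun y : ℝ => (!₂[x₀, y] : Plane) := by
      simpa using (contDiff_vertical x₀ 0 1).continuous
    exact (continuous_proj 0).comp_continuousOn
      (hF.continuousOn.comp hc.continuousOn fun y hy => hx₀ y hy)
  rw [← setIntegral_congr_fun C.Ω_open.measurableSet
      (fun x hx => hup.div_fluxField hvq hζ.contDiff hx),
    C.isPiecewiseBoundary.integral_div C.Ω_open C.Ω_bounded hF, C.flux_arc,
    ← intervalIntegral.integral_sub (hcont _ fun y hy => section_mem_closure hy)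
      (hcont _ fun y hy => section_zero_mem_closure hy)]
  congr 1
  rw [intervalIntegral.integral_of_le hab, intervalIntegral.integral_of_le hab,
    integral_Ioc_eq_integral_Ioo, integral_Ioc_eq_integral_Ioo]
  exact setIntegral_congr_fun measurableSet_Ioo fun y hy =>
    hup.fluxField_section hvq hu hv hp hζ hy

end Channel

/-! ### Rigid traces on the particle contour -/

lemma grad_mulVec (u : Plane → Plane) (x w : Plane) (k : Fin 2) :
    (grad u x *ᵥ w.ofLp) k = fderiv ℝ u x w k := by
  conv_rhs => rw [basis_expand w]
  simp [grad, Matrix.mulVec, dotProduct, Fin.sum_univ_two, mul_comm]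

lemma vecMul_rot_zero (x : Fin 2 → ℝ) : (x ᵥ* rot) 0 = x 1 := by
  simp [rot, Matrix.vecMul, dotProduct, Fin.sum_univ_two]

lemma vecMul_rot_one (x : Fin 2 → ℝ) : (x ᵥ* rot) 1 = -x 0 := by
  simp [rot, Matrix.vecMul, dotProduct, Fin.sum_univ_two]

namespace Channel

variable {C : Channel} {u v : Plane → Plane} {p q : Plane → ℝ}

lemma xc_mem_closure (s : ℝ) : C.xc s ∈ closure C.Ω := by
  refine frontier_subset_closure ?_
  rw [C.Ω_frontier]
  exact Or.inl (Or.inl (Or.inr (mem_range_self s)))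

lemma IsStokes.continuous_tangential (h : C.IsStokes u p) (k : Fin 2) :
    Continuous fun s => (tr C.Ω (grad u) (C.xc s) *ᵥ (deriv C.xc s).ofLp) k := by
  have h1 : Continuous fun s => tr C.Ω (grad u) (C.xc s) :=
    continuousOn_univ.1 (h.grad_trace.continuousOn_tr.comp C.xc_contDiff.continuous.continuousOn
      fun s _ => xc_mem_closure s)
  exact (continuous_apply k).comp (h1.matrix_mulVec ((PiLp.continuous_ofLp 2 _).comp
    (C.xc_contDiff.continuous_deriv le_rfl)))

lemma IsStokes.tr_grad_eq (h : C.IsStokes u p) {x : Plane} (hx : x ∈ C.Ω) :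
    tr C.Ω (grad u) x = grad u x :=
  tr_eq_self (continuousOn_pi.2 fun i => continuousOn_pi.2 fun j =>
    (h.contDiffOn_grad i j).continuousOn) hx

/-- The fundamental theorem of calculus for the trace of the velocity along the contour, obtained
as the limit of the one along the parallel curves inside the fluid. -/
lemma IsStokes.tr_sub_tr (h : C.IsStokes u p) (k : Fin 2) {s₀ : ℝ} (hs₀ : s₀ ∈ Ioo 0 C.ℓc) :
    ∀ᶠ s in 𝓝 s₀, tr C.Ω u (C.xc s) k - tr C.Ω u (C.xc s₀) k
      = ∫ r in s₀..s, (tr C.Ω (grad u) (C.xc r) *ᵥ (deriv C.xc r).ofLp) k := by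
  obtain ⟨η, hη, hin⟩ := arc_tube_box (C := C) 2 (s₀ := s₀) hs₀
  change ∀ z ∈ box s₀ η, 0 < z.2 → tube C.xc (rotate (deriv C.xc s₀)) z ∈ C.Ω at hin
  set N := rotate (deriv C.xc s₀)
  have hc := C.xc_contDiff
  filter_upwards [Ioo_mem_nhds (show s₀ - η < s₀ by linarith) (show s₀ < s₀ + η by linarith)]
    with s hs
  have hseg : uIcc s₀ s ⊆ Ioo (s₀ - η) (s₀ + η) :=
    (convex_Ioo _ _).ordConnected.uIcc_subset
      (show s₀ ∈ Ioo (s₀ - η) (s₀ + η) from ⟨by linarith, by linarith⟩) hs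
  have hmem : ∀ r ∈ uIcc s₀ s, ∀ t ∈ Ioo 0 η, tube C.xc N (r, t) ∈ C.Ω := fun r hr t ht =>
    hin _ ⟨hseg hr, by simpa using (neg_lt_zero.2 hη).trans ht.1, ht.2⟩ ht.1
  have hmem' : ∀ r ∈ uIcc s₀ s, ∀ t ∈ Ico 0 η, tube C.xc N (r, t) ∈ closure C.Ω := by
    intro r hr t ht
    rcases ht.1.eq_or_lt with h0 | h0
    · subst h0; simpa [tube] using xc_mem_closure (C := C) r
    · exact subset_closure (hmem r hr t ⟨h0, ht.2⟩)
  -- the integrand on a closed strip along the contour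
  set H : ℝ × ℝ → ℝ := fun z =>
    (tr C.Ω (grad u) (tube C.xc N z) *ᵥ (deriv C.xc z.1).ofLp) k with hH
  have hHc : ContinuousOn H (uIcc s₀ s ×ˢ Icc 0 (η / 2)) := by
    have h1 : ContinuousOn (fun z => tr C.Ω (grad u) (tube C.xc N z))
        (uIcc s₀ s ×ˢ Icc 0 (η / 2)) :=
      h.grad_trace.continuousOn_tr.comp (continuous_tube hc.continuous N).continuousOn
        fun z hz => hmem' z.1 hz.1 z.2 ⟨hz.2.1, by linarith [hz.2.2]⟩
    have h2 : Continuous fun z : ℝ × ℝ => (deriv C.xc z.1).ofLp :=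
      (PiLp.continuous_ofLp 2 _).comp ((hc.continuous_deriv le_rfl).comp continuous_fst)
    have h3 : Continuous fun z : Matrix (Fin 2) (Fin 2) ℝ × (Fin 2 → ℝ) => (z.1 *ᵥ z.2) k :=
      (continuous_apply k).comp (continuous_fst.matrix_mulVec continuous_snd)
    exact h3.comp_continuousOn (h1.prodMk h2.continuousOn)
  obtain ⟨M, hM⟩ := (isCompact_uIcc.prod isCompact_Icc).exists_bound_of_continuousOn hHc
  have hcol : ∀ t ∈ Icc 0 (η / 2), ContinuousOn (fun r => H (r, t)) (uIcc s₀ s) := fun t ht =>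
    hHc.comp (f := fun r : ℝ => (r, t)) (by fun_prop) fun r hr => ⟨hr, ht⟩
  have hsmall : ∀ᶠ t in 𝓝[>] (0 : ℝ), t ∈ Ioc 0 (η / 2) := Ioc_mem_nhdsGT (by linarith)
  have hFTC : ∀ t ∈ Ioc 0 (η / 2),
      ∫ r in s₀..s, H (r, t) = u (tube C.xc N (s, t)) k - u (tube C.xc N (s₀, t)) k := by
    intro t ht
    have ht' : t ∈ Ioo 0 η := ⟨ht.1, by linarith [ht.2]⟩
    refine intervalIntegral.integral_eq_sub_of_hasDerivAt (f := fun r => u (tube C.xc N (r, t)) k)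
      (fun r hr => ?_) (hcol t (Ioc_subset_Icc_self ht)).intervalIntegrable
    have hx := hmem r hr t ht'
    have h1 : HasDerivAt (fun r => tube C.xc N (r, t)) (deriv C.xc r) r :=
      ((hc.differentiable one_ne_zero r).hasDerivAt).sub_const (t • N)
    have h2 : HasFDerivAt u (fderiv ℝ u (tube C.xc N (r, t))) (tube C.xc N (r, t)) :=
      ((h.u_contDiff.differentiableOn two_ne_zero).differentiableAt
        (C.Ω_open.mem_nhds hx)).hasFDerivAt
    have h3 := hasDerivAt_apply (h2.comp_hasDerivAt r h1) k
    simp only [hH, h.tr_grad_eq hx, grad_mulVec]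
    exact h3
  have lim1 : Tendsto (fun t => ∫ r in s₀..s, H (r, t)) (𝓝[>] 0)
      (𝓝 (∫ r in s₀..s, (tr C.Ω (grad u) (C.xc r) *ᵥ (deriv C.xc r).ofLp) k)) := by
    refine intervalIntegral.tendsto_integral_filter_of_dominated_convergence (fun _ => M)
      ?_ ?_ intervalIntegrable_const ?_
    · filter_upwards [hsmall] with t ht
      exact ((hcol t (Ioc_subset_Icc_self ht)).mono uIoc_subset_uIcc).aestronglyMeasurable
        measurableSet_uIoc
    · filter_upwards [hsmall] with t ht
      exact Eventually.of_forall fun r hr =>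
        hM (r, t) ⟨uIoc_subset_uIcc hr, Ioc_subset_Icc_self ht⟩
    · refine Eventually.of_forall fun r hr => ?_
      have h1 := hHc (r, 0) ⟨uIoc_subset_uIcc hr, le_rfl, by linarith⟩
      have h2 : Tendsto (fun t : ℝ => (r, t)) (𝓝[>] 0)
          (𝓝[uIcc s₀ s ×ˢ Icc 0 (η / 2)] (r, 0)) := by
        refine tendsto_nhdsWithin_iff.2
          ⟨tendsto_const_nhds.prodMk_nhds nhdsWithin_le_nhds, ?_⟩
        filter_upwards [hsmall] with t ht
        exact ⟨uIoc_subset_uIcc hr, Ioc_subset_Icc_self ht⟩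
      simpa [hH, tube, Function.comp_def] using h1.tendsto.comp h2
  have lim2 : ∀ r ∈ uIcc s₀ s, Tendsto (fun t => u (tube C.xc N (r, t)) k) (𝓝[>] 0)
      (𝓝 (tr C.Ω u (C.xc r) k)) := by
    intro r hr
    have h1 := h.u_trace.tendsto (xc_mem_closure r)
    have h2 : Tendsto (fun t => tube C.xc N (r, t)) (𝓝[>] 0) (𝓝[C.Ω] (C.xc r)) := by
      refine tendsto_nhdsWithin_iff.2 ⟨tendsto_tube hc.continuous N r nhdsWithin_le_nhds, ?_⟩
      filter_upwards [hsmall] with t ht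
      exact hmem r hr t ⟨ht.1, by linarith [ht.2]⟩
    exact ((continuous_proj k).tendsto _).comp (h1.comp h2)
  refine tendsto_nhds_unique ((lim2 s right_mem_uIcc).sub (lim2 s₀ left_mem_uIcc)) ?_
  refine lim1.congr' ?_
  filter_upwards [hsmall] with t ht using hFTC t ht

lemma rotate_apply (x : Plane) (k : Fin 2) : rotate x k = ![-x 1, x 0] k := by
  fin_cases k
  · exact rotate_zero x
  · exact rotate_one x

/-- Differentiating a rigid trace along the contour: `∇u · τ = ϱ n`. -/
lemma IsStokes.grad_mulVec_tangent (h : C.IsStokes u p) {w : Plane} {ϱ : ℝ}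
    (hr : C.HasRigidTrace u w ϱ) (s : ℝ) (k : Fin 2) :
    (tr C.Ω (grad u) (C.xc s) *ᵥ (C.τc s).ofLp) k = ϱ * C.nc s k := by
  have hc := C.xc_contDiff
  have hcd : Continuous (deriv C.xc) := hc.continuous_deriv le_rfl
  have hrot : Continuous fun s => ϱ * rotate (deriv C.xc s) k := by
    simp only [rotate_apply]
    fin_cases k
    · exact continuous_const.mul ((continuous_proj 1).comp hcd).neg
    · exact continuous_const.mul ((continuous_proj 0).comp hcd)
  have hopen : ∀ s ∈ Ioo 0 C.ℓc, (tr C.Ω (grad u) (C.xc s) *ᵥ (deriv C.xc s).ofLp) k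
      = ϱ * rotate (deriv C.xc s) k := by
    intro s₀ hs₀
    have d1 : HasDerivAt (fun s => tr C.Ω u (C.xc s) k)
        ((tr C.Ω (grad u) (C.xc s₀) *ᵥ (deriv C.xc s₀).ofLp) k) s₀ := by
      have h1 := (((h.continuous_tangential k).integral_hasStrictDerivAt s₀ s₀).hasDerivAt).add_const
        (tr C.Ω u (C.xc s₀) k)
      refine h1.congr_of_eventuallyEq ?_
      filter_upwards [h.tr_sub_tr k hs₀] with s hs
      rw [← hs]; ring
    have d2 : HasDerivAt (fun s => tr C.Ω u (C.xc s) k) (ϱ * rotate (deriv C.xc s₀) k) s₀ := by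
      have hx : ∀ j, HasDerivAt (fun s => C.xc s j) (deriv C.xc s₀ j) s₀ :=
        hasDerivAt_apply (hc.differentiable one_ne_zero s₀).hasDerivAt
      have h1 : (fun s => tr C.Ω u (C.xc s) k) = fun s => w k + ϱ * rotate (C.xc s) k := by
        funext s; rw [hr s]; simp
      rw [h1]
      simp only [rotate_apply]
      fin_cases k
      · exact (((hx 1).neg).const_mul ϱ).const_add _
      · exact ((hx 0).const_mul ϱ).const_add _
    exact d1.unique d2
  have hIcc : ∀ s ∈ Icc 0 C.ℓc, (tr C.Ω (grad u) (C.xc s) *ᵥ (deriv C.xc s).ofLp) k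
      = ϱ * rotate (deriv C.xc s) k := by
    have hcl : IsClosed {s | (tr C.Ω (grad u) (C.xc s) *ᵥ (deriv C.xc s).ofLp) k
        = ϱ * rotate (deriv C.xc s) k} := isClosed_eq (h.continuous_tangential k) hrot
    intro s hs
    rw [← closure_Ioo C.ℓc_pos.ne] at hs
    exact closure_minimal hopen hcl hs
  have hper : Function.Periodic C.xc C.ℓc := C.xc_period
  have hper' : Function.Periodic (deriv C.xc) C.ℓc := fun s => by
    rw [← deriv_comp_add_const]
    exact congrArg (fun f => deriv f s) (funext C.xc_period)
  have hper2 : Function.Periodic (fun s => (C.xc s, deriv C.xc s)) C.ℓc := fun s => by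
    simp only [hper s, hper' s]
  obtain ⟨t, ht, hst⟩ := hper2.exists_mem_Ico₀ C.ℓc_pos s
  have e1 : C.xc s = C.xc t := congrArg Prod.fst hst
  have e2 : deriv C.xc s = deriv C.xc t := congrArg Prod.snd hst
  rw [nc, τc, e1, e2]
  exact hIcc t (Ico_subset_Icc_self ht)

lemma IsStokes.trace_tr_grad (h : C.IsStokes u p) {x : Plane} (hx : x ∈ closure C.Ω) :
    (tr C.Ω (grad u) x).trace = 0 := by
  rw [← h.grad_trace.tr_comp (Φ := Matrix.trace) (by fun_prop) hx]
  refine tr_eq_of_tendsto hx (tendsto_const_nhds.congr' ?_)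
  filter_upwards [self_mem_nhdsWithin] with y hy using (h.incompressible y hy).symm

lemma IsStokes.tr_stress (h : C.IsStokes u p) {x : Plane} (hx : x ∈ closure C.Ω) :
    tr C.Ω (stress u p) x = -(tr C.Ω p x • (1 : Matrix (Fin 2) (Fin 2) ℝ))
      + (2 : ℝ) • ((1 / 2 : ℝ) • (tr C.Ω (grad u) x + (tr C.Ω (grad u) x)ᵀ)) := by
  have := (h.grad_trace.prodMk h.p_trace).tr_comp
    (Φ := fun z => -(z.2 • (1 : Matrix (Fin 2) (Fin 2) ℝ))
      + (2 : ℝ) • ((1 / 2 : ℝ) • (z.1 + z.1ᵀ))) (by fun_prop) hx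
  rw [h.grad_trace.tr_prodMk h.p_trace hx] at this
  exact this

lemma sq_add_sq_τc (s : ℝ) : C.τc s 0 ^ 2 + C.τc s 1 ^ 2 = 1 := by
  have h := C.xc_unit s
  rw [EuclideanSpace.norm_eq, Real.sqrt_eq_one, Fin.sum_univ_two] at h
  simpa [τc] using h

lemma rot_eq (s : ℝ) : rot =
    vecMulVec (C.nc s).ofLp (C.τc s).ofLp - vecMulVec (C.τc s).ofLp (C.nc s).ofLp := by
  have h := sq_add_sq_τc (C := C) s
  ext i j
  fin_cases i <;> fin_cases j <;>
    simp [rot, vecMulVec_apply, nc, rotate_zero, rotate_one] <;> linarith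

/-- A trace-free matrix mapping the unit vector `τ` to `ϱ n`, `n = r · τ`, is
`β τ ⊗ n + ϱ n ⊗ τ` for some `β`. -/
lemma exists_eq_of_mulVec_tangent {A : Matrix (Fin 2) (Fin 2) ℝ} {τ₀ τ₁ ϱ : ℝ}
    (hτ : τ₀ ^ 2 + τ₁ ^ 2 = 1) (htr : A 0 0 + A 1 1 = 0)
    (h0 : A 0 0 * τ₀ + A 0 1 * τ₁ = -(ϱ * τ₁)) (h1 : A 1 0 * τ₀ + A 1 1 * τ₁ = ϱ * τ₀) :
    ∃ β, A 0 0 = -(β + ϱ) * τ₀ * τ₁ ∧ A 0 1 = β * τ₀ ^ 2 - ϱ * τ₁ ^ 2 ∧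
      A 1 0 = ϱ * τ₀ ^ 2 - β * τ₁ ^ 2 ∧ A 1 1 = (β + ϱ) * τ₀ * τ₁ := by
  refine ⟨A 0 1 - A 1 0 + ϱ, ?_, ?_, ?_, ?_⟩ <;> grind

lemma IsStokes.exists_grad_eq (h : C.IsStokes u p) {w : Plane} {ϱ : ℝ}
    (hr : C.HasRigidTrace u w ϱ) (s : ℝ) :
    ∃ β, tr C.Ω (grad u) (C.xc s) 0 0 = -(β + ϱ) * C.τc s 0 * C.τc s 1 ∧
      tr C.Ω (grad u) (C.xc s) 0 1 = β * C.τc s 0 ^ 2 - ϱ * C.τc s 1 ^ 2 ∧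
      tr C.Ω (grad u) (C.xc s) 1 0 = ϱ * C.τc s 0 ^ 2 - β * C.τc s 1 ^ 2 ∧
      tr C.Ω (grad u) (C.xc s) 1 1 = (β + ϱ) * C.τc s 0 * C.τc s 1 := by
  have htr := h.trace_tr_grad (xc_mem_closure s)
  have h0 := h.grad_mulVec_tangent hr s 0
  have h1 := h.grad_mulVec_tangent hr s 1
  rw [Matrix.trace_fin_two] at htr
  simp only [Matrix.mulVec, dotProduct, Fin.sum_univ_two, nc, rotate_zero, rotate_one] at h0 h1
  exact exists_eq_of_mulVec_tangent (sq_add_sq_τc s) htr (by linarith) h1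

/-- The flux of `E` through the contour for rigid traces. With `∇u = β τ ⊗ n + ϱ n ⊗ τ` and
`∇v = β' τ ⊗ n + ϱ' n ⊗ τ` on the contour, the tangential tractions are `β + ϱ` and `β' + ϱ'`. -/
lemma IsStokes.vecMul_tensorE (h : C.IsStokes u p) (h' : C.IsStokes v q) {w w' : Plane} {ϱ ϱ' : ℝ}
    (hr : C.HasRigidTrace u w ϱ) (hr' : C.HasRigidTrace v w' ϱ') (s : ℝ) :
    (C.nc s).ofLp ᵥ* tr C.Ω (tensorE u p v q) (C.xc s) =
      -((ϱ' • C.traction u p s + ϱ • C.traction v q s) ᵥ* rot)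
        - (C.tangentialTraction u p s * C.tangentialTraction v q s) • (C.nc s).ofLp := by
  have hx := xc_mem_closure (C := C) s
  obtain ⟨β, a00, a01, a10, a11⟩ := h.exists_grad_eq hr s
  obtain ⟨β', b00, b01, b10, b11⟩ := h'.exists_grad_eq hr' s
  have hτ := sq_add_sq_τc (C := C) s
  have n0 : C.nc s 0 = -C.τc s 1 := rotate_zero _
  have n1 : C.nc s 1 = C.τc s 0 := rotate_one _
  have t0 : C.traction u p s 0
      = tr C.Ω p (C.xc s) * C.τc s 1 + (β + ϱ) * C.τc s 0 := by
    simp only [traction, h.tr_stress hx, Matrix.mulVec, dotProduct, Fin.sum_univ_two, n0, n1]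
    simp [a00, a01, a10]
    linear_combination (β + ϱ) * C.τc s 0 * hτ
  have t1 : C.traction u p s 1
      = -tr C.Ω p (C.xc s) * C.τc s 0 + (β + ϱ) * C.τc s 1 := by
    simp only [traction, h.tr_stress hx, Matrix.mulVec, dotProduct, Fin.sum_univ_two, n0, n1]
    simp [a11, a01, a10]
    linear_combination (β + ϱ) * C.τc s 1 * hτ
  have t0' : C.traction v q s 0
      = tr C.Ω q (C.xc s) * C.τc s 1 + (β' + ϱ') * C.τc s 0 := by
    simp only [traction, h'.tr_stress hx, Matrix.mulVec, dotProduct, Fin.sum_univ_two, n0, n1]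
    simp [b00, b01, b10]
    linear_combination (β' + ϱ') * C.τc s 0 * hτ
  have t1' : C.traction v q s 1
      = -tr C.Ω q (C.xc s) * C.τc s 0 + (β' + ϱ') * C.τc s 1 := by
    simp only [traction, h'.tr_stress hx, Matrix.mulVec, dotProduct, Fin.sum_univ_two, n0, n1]
    simp [b11, b01, b10]
    linear_combination (β' + ϱ') * C.τc s 1 * hτ
  have ht : C.tangentialTraction u p s = β + ϱ := by
    simp only [tangentialTraction, dotProduct, Fin.sum_univ_two, t0, t1]
    linear_combination (β + ϱ) * hτ
  have ht' : C.tangentialTraction v q s = β' + ϱ' := by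
    simp only [tangentialTraction, dotProduct, Fin.sum_univ_two, t0', t1']
    linear_combination (β' + ϱ') * hτ
  rw [h.tr_tensorE h' hx, ht, ht']
  have v0 : ∀ M : Matrix (Fin 2) (Fin 2) ℝ, ∀ j,
      ((C.nc s).ofLp ᵥ* M) j = -C.τc s 1 * M 0 j + C.τc s 0 * M 1 j := fun M j => by
    rw [Matrix.vecMul, dotProduct, Fin.sum_univ_two, n0, n1]
  -- If `|τ|² = R`, with `k = h_s h_s' - h_s β' - h_s' β`, the two sides differ by
  -- `k (R² - 1) n + (p ϱ' + q ϱ) (R - 1) τ`; this gives the multiples of `R = 1` below.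
  ext j
  fin_cases j <;> simp only [Fin.zero_eta, Fin.mk_one, Fin.isValue, v0, Pi.sub_apply, Pi.neg_apply,
    vecMul_rot_zero, vecMul_rot_one, Pi.add_apply, Pi.smul_apply, smul_eq_mul, pointE_zero_zero,
    pointE_one_zero, pointE_zero_one, pointE_one_one, n0, n1, t0, t1, t0', t1', a00, a01, a10, a11,
    b00, b01, b10, b11]
  · linear_combination (((β + ϱ) * (β' + ϱ') - (β + ϱ) * β' - (β' + ϱ') * β) * (C.τc s 0 ^ 2 + C.τc s 1 ^ 2 + 1) * -C.τc s 1
      + (tr C.Ω p (C.xc s) * ϱ' + tr C.Ω q (C.xc s) * ϱ) * C.τc s 0) * hτ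
  · linear_combination (((β + ϱ) * (β' + ϱ') - (β + ϱ) * β' - (β' + ϱ') * β) * (C.τc s 0 ^ 2 + C.τc s 1 ^ 2 + 1) * C.τc s 0
      + (tr C.Ω p (C.xc s) * ϱ' + tr C.Ω q (C.xc s) * ϱ) * C.τc s 1) * hτ

end Channel

end StokesChannel

end

theorem lemma3p3 (C : StokesChannel.Channel)
    (Ωall : Set StokesChannel.Plane) (hΩall : IsOpen Ωall) (hΩ : closure C.Ω ⊆ Ωall)
    (u v : StokesChannel.Plane → StokesChannel.Plane) (p q : StokesChannel.Plane → ℝ)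
    (hup : C.IsStokes u p) (hvq : C.IsStokes v q)
    (hu : C.IsPeriodicVelocity u) (hv : C.IsPeriodicVelocity v) (hp : C.IsPeriodicPressure p) :
    (∀ ζ : StokesChannel.Plane → StokesChannel.Plane, C.IsTestField Ωall ζ →
      ∫ x in C.Ω, StokesChannel.ddot (StokesChannel.tensorE u p v q x) (StokesChannel.grad ζ x)ᵀ =
        C.boundaryIntegral (StokesChannel.tr C.Ω (StokesChannel.tensorE u p v q)) ζ
          + ∫ y in C.a..C.b,
              C.jump q y * StokesChannel.tr C.Ω (StokesChannel.grad u) !₂[C.L, y] 0 1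
                * ζ !₂[C.L, y] 1) ∧
    (∀ s : ℝ, StokesChannel.rot =
      vecMulVec (C.nc s).ofLp (C.τc s).ofLp - vecMulVec (C.τc s).ofLp (C.nc s).ofLp) ∧
    (∀ (w w' : StokesChannel.Plane) (ϱ ϱ' : ℝ), C.HasRigidTrace u w ϱ → C.HasRigidTrace v w' ϱ' →
      ∀ s : ℝ,
        (C.nc s).ofLp ᵥ* StokesChannel.tr C.Ω (StokesChannel.tensorE u p v q) (C.xc s) =
          -((ϱ' • C.traction u p s + ϱ • C.traction v q s) ᵥ* StokesChannel.rot)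
            - (C.tangentialTraction u p s * C.tangentialTraction v q s) • (C.nc s).ofLp) := by
  exact ⟨fun ζ hζ => hup.integral_tensorE hvq hu hv hp hζ, StokesChannel.Channel.rot_eq,
    fun w w' ϱ ϱ' hr hr' s => hup.vecMul_tensorE hvq hr hr' s⟩
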